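/- **Maximum Coverage on streams with bounded multiplicity.** Let $S_1,\dots,S_m\subseteq[n]$ be sets such that every element of $[n]$ lies in at most $r\ge 1$ of them, let $1\le k\le m$ and $0<\varepsilon\le 1$. The sets arrive in a stream in arbitrary order, each as a list of its elements (in arbitrary order, without repetition) followed by an end marker; $n,m,k,r,\varepsilon$ are known in advance. Maximum Coverage asks for at most $k$ of the sets whose union is as large as possible; let $\mathrm{OPT}$ be the size of the largest such union. There is a randomized one-pass streaming algorithm that uses $\tilde O(k^2 r/\varepsilon^3)$ bits of space and, with high probability, returns (the indices of) at most $k$ of the sets whose union has size at least $\mathrm{OPT}/(1+\varepsilon)$. Here $\tilde O$ hides factors polylogarithmic in $m$ and $n$, space is the number of bits of memory held between consecutive stream tokens (including all random bits that are reused), and "with high probability" means with failure probability inversely polynomial in $m$. Precisely: for every $a\in\mathbb N$ there are constants $C,c$ such that for all $n,m,k,r,\varepsilon$ as above there is such an algorithm with space at most $C\,\frac{k^2r}{\varepsilon^3}\,\log^c(n+m+2)$ whose failure probability is at most $m^{-a}$ on every such stream. Moreover, the algorithm can be taken of the following form. Put $\eta=\varepsilon/6$. It keeps $F_0$ sketches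 (with a common random seed) of the $\lceil rk/\eta\rceil$ largest sets of the stream (of all sets if there are fewer), ties broken arbitrarily, and at the end returns $k$ of these sets with the largest coverage as estimated from the sketches. The $F_0$ sketch estimates the number of distinct elements of any fixed collection of sets, from the sketches of these sets, up to a relative error $\eta$, except with probability at most $1/\bigl((n+m)^a\binom mk\bigr)$. -/

import Mathlib

noncomputable section

namespace StreamCoverage

open Classical

/-- The probability of the event `E` under the discrete distribution `p`. -/
def prob {α : Type} (p : PMF α) (E : Set α) : ℝ := (p.toOuterMeasure E).toReal

/-! ### Randomized one-pass streaming algorithms -/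

/-- A randomized one-pass streaming algorithm reading tokens from `Tok` and answering in `Out`.
Its whole memory between two tokens is an element of the finite type `State`; in particular random
choices that are to be used again later have to be kept in the memory. The initial memory, each
update and the final answer may use fresh randomness. -/
structure StreamAlgorithm (Tok Out : Type) where
  State : Type
  finite_state : Finite State
  init : PMF State
  step : State → Tok → PMF State
  output : State → PMF Out

namespace StreamAlgorithm

variable {Tok Out : Type}

/-- The distribution of the memory after reading a stream, starting from memory `s`. -/
def runFrom (A : StreamAlgorithm Tok Out) : A.State → List Tok → PMF A.State
  | s, [] => PMF.pure s
  | s, t :: l => (A.step s t).bind fun s' => runFrom A s' l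

/-- The distribution of the answer after a single pass over a stream. -/
def run (A : StreamAlgorithm Tok Out) (l : List Tok) : PMF Out :=
  (A.init.bind fun s => A.runFrom s l).bind A.output

/-- The space used, in bits: the least `b` such that the memory has at most `2 ^ b` states. -/
def space (A : StreamAlgorithm Tok Out) : ℕ := Nat.clog 2 (Nat.card A.State)

end StreamAlgorithm

/-! ### Maximum coverage and its input streams -/

/-- `m` subsets of `{0, …, n - 1}`, each given as the list of its elements, without repetition and
in an arbitrary order. -/
structure SetStream (n m : ℕ) where
  elems : Fin m → List (Fin n)
  nodup : ∀ i, (elems i).Nodup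

/-- The tokens of a stream of sets: an element of the current set, or the end of that set. -/
inductive Token (n : ℕ) : Type where
  | elem (x : Fin n) : Token n
  | endSet : Token n

namespace SetStream

variable {n m : ℕ}

/-- The `i`-th set of the stream. -/
def set (S : SetStream n m) (i : Fin m) : Finset (Fin n) := (S.elems i).toFinset

/-- The token stream: the elements of the first set, an end marker, the elements of the second set,
an end marker, and so on. -/
def tokens (S : SetStream n m) : List (Token n) :=
  (List.finRange m).flatMap fun i => (S.elems i).map Token.elem ++ [Token.endSet]

/-- The number of sets of the stream that contain `x`. -/
def multiplicity (S : SetStream n m) (x : Fin n) : ℕ :=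
  (Finset.univ.filter fun i => x ∈ S.set i).card

/-- The number of elements covered by the sets with index in `I`. -/
def coverage (S : SetStream n m) (I : Finset (Fin m)) : ℕ := (I.biUnion S.set).card

/-- The optimum of maximum coverage: the largest coverage of at most `k` of the sets. -/
def opt (S : SetStream n m) (k : ℕ) : ℕ :=
  (Finset.univ.filter fun I : Finset (Fin m) => I.card ≤ k).sup S.coverage

/-- `I` is a feasible solution whose coverage is within a factor `α` of the optimum. -/
def IsApprox (S : SetStream n m) (k : ℕ) (α : ℝ) (I : Finset (Fin m)) : Prop :=
  I.card ≤ k ∧ (S.opt k : ℝ) ≤ α * S.coverage I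

end SetStream

/-! ### Sketches for the number of distinct elements -/

/-- A mergeable sketching scheme for subsets of `{0, …, n - 1}`. A random seed is shared by all
sketches; a sketch is built by processing the elements of a set one at a time; from the seed and
the sketches of several sets a number is computed. -/
structure SketchScheme (n : ℕ) where
  Seed : Type
  finite_seed : Finite Seed
  Sk : Type
  finite_sk : Finite Sk
  seedDist : PMF Seed
  empty : Seed → Sk
  add : Seed → Sk → Fin n → Sk
  estimate : Seed → Multiset Sk → ℝ

namespace SketchScheme

variable {n : ℕ}

/-- The sketch, under seed `ω`, of the set listed by `l`. -/
def sketch (Φ : SketchScheme n) (ω : Φ.Seed) (l : List (Fin n)) : Φ.Sk :=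
  l.foldl (Φ.add ω) (Φ.empty ω)

/-- The number of distinct elements in a collection of listed sets. -/
def distinct (C : Multiset (List (Fin n))) : ℕ :=
  (Finset.univ.filter fun x : Fin n => ∃ l ∈ C, x ∈ l).card

/-- `Φ` is an `F₀` sketch with relative error `η` and failure probability `δ`: for every collection
of sets, the number of distinct elements is estimated from the sketches of these sets up to
relative error `η`, except with probability at most `δ`. -/
def IsF0Sketch (Φ : SketchScheme n) (η δ : ℝ) : Prop :=
  ∀ C : Multiset (List (Fin n)),
    prob Φ.seedDist
      {ω | ¬ |Φ.estimate ω (C.map (Φ.sketch ω)) - distinct C| ≤ η * distinct C} ≤ δ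

end SketchScheme

/-! ### Keeping sketches of the largest sets -/

/-- An element of the nonempty finite set `T` at which `f` is smallest, ties broken arbitrarily. -/
def argmin {α β : Type} [LinearOrder β] (f : α → β) (T : Finset α) (h : T.Nonempty) : α :=
  (T.exists_min_image f h).choose

theorem argmin_mem {α β : Type} [LinearOrder β] (f : α → β) (T : Finset α) (h : T.Nonempty) :
    argmin f T h ∈ T :=
  (T.exists_min_image f h).choose_spec.1

/-- An element of the nonempty finite set `T` at which `f` is largest, ties broken arbitrarily. -/
def argmax {α β : Type} [LinearOrder β] (f : α → β) (T : Finset α) (h : T.Nonempty) : α :=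
  (T.exists_max_image f h).choose

/-- What is kept of a set: its index in the stream, its size and its sketch. -/
abbrev Record (n m : ℕ) (Sk : Type) : Type := Fin m × Fin (n + 1) × Sk

/-- At most `K` records. -/
abbrev Store (n m K : ℕ) (Sk : Type) : Type := {T : Finset (Record n m Sk) // T.card ≤ K}

/-- Put a record into the store; if it then holds more than `K` records, throw out one whose set
has the smallest size. -/
def Store.put {n m K : ℕ} {Sk : Type} (T : Store n m K Sk) (ρ : Record n m Sk) :
    Store n m K Sk :=
  if h : (insert ρ T.1).card ≤ K then ⟨insert ρ T.1, h⟩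
  else
    ⟨(insert ρ T.1).erase (argmin (fun σ => σ.2.1) (insert ρ T.1) (Finset.insert_nonempty ρ T.1)),
      by
        rw [Finset.card_erase_of_mem (argmin_mem _ _ _)]
        have h₁ := Finset.card_insert_le ρ T.1
        have h₂ := T.2
        omega⟩

/-- The memory of the algorithm: the seed of the sketches; the number of sets completed so far,
and the size and the sketch of the part of the current set that has been read; the store. -/
abbrev Memory (n m K : ℕ) (Φ : SketchScheme n) : Type :=
  Φ.Seed × (Fin (m + 1) × Fin (n + 1) × Φ.Sk) × Store n m K Φ.Sk

/-- Add one to a counter that takes the values `0, …, N`, unless it is at its end. -/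
def incr {N : ℕ} (c : Fin (N + 1)) : Fin (N + 1) :=
  if h : (c : ℕ) + 1 < N + 1 then ⟨c + 1, h⟩ else c

/-- Process one token: an element is added to the sketch of the current set and counted; at the end
of a set its record is put into the store and a new set is begun. (On the streams in question
neither counter ever overflows.) -/
def update {n m K : ℕ} {Φ : SketchScheme n} : Memory n m K Φ → Token n → Memory n m K Φ
  | (ω, (i, s, σ), T), Token.elem x => (ω, (i, incr s, Φ.add ω σ x), T)
  | (ω, (i, s, σ), T), Token.endSet =>
      (ω, (incr i, 0, Φ.empty ω), if h : (i : ℕ) < m then T.put (⟨i, h⟩, s, σ) else T)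

/-- The estimated coverage of a set of stored records. -/
def estimatedCoverage {n m : ℕ} (Φ : SketchScheme n) (ω : Φ.Seed)
    (J : Finset (Record n m Φ.Sk)) : ℝ :=
  Φ.estimate ω (J.val.map fun ρ => ρ.2.2)

/-- The indices of `k` stored sets with the largest estimated coverage (none if fewer than `k` sets
are stored). -/
def bestOf {n m K : ℕ} {Φ : SketchScheme n} (k : ℕ) : Memory n m K Φ → Finset (Fin m)
  | (ω, _, T) =>
      if h : (T.1.powersetCard k).Nonempty then
        (argmax (estimatedCoverage Φ ω) (T.1.powersetCard k) h).image Prod.fst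
      else ∅

/-- The algorithm that draws a seed, keeps the sketches of the `K` largest sets of the stream, and
at the end returns `k` of these sets with the largest estimated coverage. -/
def largestSets (n m K k : ℕ) (Φ : SketchScheme n) :
    StreamAlgorithm (Token n) (Finset (Fin m)) where
  State := Memory n m K Φ
  finite_state := by
    have := Φ.finite_seed
    have := Φ.finite_sk
    infer_instance
  init := Φ.seedDist.bind fun ω => PMF.pure (ω, (0, 0, Φ.empty ω), ⟨∅, by simp⟩)
  step s t := PMF.pure (update s t)
  output s := PMF.pure (bestOf k s)

end StreamCoverage

end

noncomputable section

namespace StreamCoverage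

open Classical

/-! ### Probabilities -/

/-! Three estimates are combined.

Keeping only large sets is harmless. If a set of an optimal solution is not stored, the store holds
`K` sets at least as large. Each point of the optimal union `U` lies in at most `r` of them, so by
averaging one of them meets `U` in at most `r|U|/K` points. Exchanging it for the missing set loses
at most `r·opt/K` (`coverage_exchange`), and at most `k` exchanges lose at most `η·opt`
(`exists_large_coverage`).

Estimation is harmless. Once every `k`-subset of the stream is estimated within a factor `1 ± η`,
the chosen sets cover at least `(1-η)²/(1+η)·opt`, which is at least `opt/(1+6η)` for `η ≤ 1/6`
(`isApprox_bestOf`). A union bound over the `k`-subsets costs the factor `m.choose k`.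

A small sketch exists. Hash by a random affine map modulo a prime `p`, and keep the elements below
the largest threshold `θ` that leaves at most `s`; the size is then about `sp/θ`. A wrong estimate
makes the count below one of two fixed thresholds deviate, which Chebyshev's inequality and pairwise
independence make unlikely once `s ≥ 400/η²` (`card_inaccurate_le`). The median of `t` independent
copies fails with probability at most `2⁻ᵗ`. Taking `t` of order `k log(n+m)` beats `m.choose k`,
and `K·t·s` words of logarithmic length give the space bound. -/

theorem toOuterMeasure_ne_top {α : Type} (p : PMF α) (E : Set α) : p.toOuterMeasure E ≠ ⊤ := by
  refine ne_top_of_le_ne_top ENNReal.one_ne_top ?_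
  rw [← (p.toOuterMeasure_apply_eq_one_iff Set.univ).2 (Set.subset_univ p.support)]
  exact p.toOuterMeasure.mono (Set.subset_univ E)

theorem prob_mono {α : Type} (p : PMF α) {E F : Set α} (h : E ⊆ F) : prob p E ≤ prob p F :=
  ENNReal.toReal_mono (toOuterMeasure_ne_top p F) (p.toOuterMeasure.mono h)

theorem prob_biUnion_le {α ι : Type} (p : PMF α) (s : Finset ι) (E : ι → Set α) :
    prob p (⋃ i ∈ s, E i) ≤ ∑ i ∈ s, prob p (E i) := by
  unfold prob
  rw [← ENNReal.toReal_sum fun i _ => toOuterMeasure_ne_top p _]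
  refine ENNReal.toReal_mono ?_ (MeasureTheory.measure_biUnion_finset_le s E)
  exact ENNReal.sum_ne_top.2 fun i _ => toOuterMeasure_ne_top p _

theorem prob_map {α β : Type} (p : PMF α) (f : α → β) (E : Set β) :
    prob (p.map f) E = prob p (f ⁻¹' E) := by
  simp [prob, PMF.toOuterMeasure_map_apply]

theorem prob_uniform {α : Type} [Fintype α] [Nonempty α] (E : Set α) :
    prob (PMF.uniformOfFintype α) E
      = ((Finset.univ.filter fun a => a ∈ E).card : ℝ) / Fintype.card α := by
  unfold prob
  rw [PMF.toOuterMeasure_uniformOfFintype_apply, ENNReal.toReal_div]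
  simp only [ENNReal.toReal_natCast]
  congr 2
  rw [Fintype.card_subtype]

/-! ### Coverage by the largest sets -/

namespace SetStream

variable {n m : ℕ}

theorem coverage_le_opt (S : SetStream n m) {k : ℕ} {I : Finset (Fin m)} (h : I.card ≤ k) :
    S.coverage I ≤ S.opt k :=
  Finset.le_sup (f := S.coverage) (by simpa using h)

theorem exists_coverage_eq_opt (S : SetStream n m) (k : ℕ) :
    ∃ I : Finset (Fin m), I.card ≤ k ∧ S.coverage I = S.opt k := by
  obtain ⟨I, hI, h⟩ := Finset.exists_mem_eq_sup
    (Finset.univ.filter fun I : Finset (Fin m) => I.card ≤ k) ⟨∅, by simp⟩ S.coverage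
  exact ⟨I, by simpa using hI, h.symm⟩

theorem coverage_mono (S : SetStream n m) {I J : Finset (Fin m)} (h : I ⊆ J) :
    S.coverage I ≤ S.coverage J :=
  Finset.card_le_card (Finset.biUnion_subset_biUnion_of_subset_left _ h)

/-- Double counting: each point of `U` is counted once for every set of `P` containing it. -/
theorem sum_card_inter_le (S : SetStream n m) {r : ℕ} (hr : ∀ x, S.multiplicity x ≤ r)
    (P : Finset (Fin m)) (U : Finset (Fin n)) :
    ∑ i ∈ P, (S.set i ∩ U).card ≤ r * U.card := by
  have h := Finset.sum_card_bipartiteAbove_eq_sum_card_bipartiteBelow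
    (s := P) (t := U) (fun i x => x ∈ S.set i)
  have h1 : ∀ i, (S.set i ∩ U) = Finset.bipartiteAbove (fun i x => x ∈ S.set i) U i := by
    intro i; ext x; simp [Finset.bipartiteAbove, and_comm]
  simp only [h1]
  rw [h, mul_comm]
  refine Finset.sum_le_card_nsmul _ _ _ fun x _ => (Finset.card_le_card ?_).trans (hr x)
  intro i; simp [Finset.bipartiteBelow]

/-- Among many sets of bounded multiplicity there is one that meets a given set in few points. -/
theorem exists_card_inter_le (S : SetStream n m) {r K : ℕ} (hr : ∀ x, S.multiplicity x ≤ r)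
    (P : Finset (Fin m)) (hK : 0 < K) (hP : K ≤ P.card) (U : Finset (Fin n)) :
    ∃ i ∈ P, K * (S.set i ∩ U).card ≤ r * U.card := by
  by_contra! hcon
  have hne : P.Nonempty := Finset.card_pos.1 (hK.trans_le hP)
  have h1 : ∑ _i ∈ P, r * U.card < ∑ i ∈ P, K * (S.set i ∩ U).card :=
    Finset.sum_lt_sum_of_nonempty hne hcon
  rw [Finset.sum_const, smul_eq_mul, ← Finset.mul_sum] at h1
  have h2 := Nat.mul_le_mul_left K (S.sum_card_inter_le hr P U)
  have h3 := Nat.mul_le_mul_right (r * U.card) hP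
  omega

/-- Exchanging one set for another that is at least as large loses at most the intersection of
the new set with the old union. -/
theorem coverage_exchange (S : SetStream n m) (I : Finset (Fin m)) {i j : Fin m}
    (h : (S.set j).card ≤ (S.set i).card) :
    S.coverage I ≤ S.coverage (insert i (I.erase j)) + (S.set i ∩ I.biUnion S.set).card := by
  set U := I.biUnion S.set with hU
  -- Removing the `j`-th set can only uncover its own points. If `i` already lies in `I`, then
  -- `S.set i \ U` is empty and the bound still holds.
  have hsub : (U \ S.set j) ∪ (S.set i \ U) ⊆ (insert i (I.erase j)).biUnion S.set := by
    intro x hx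
    simp only [Finset.mem_union, Finset.mem_sdiff, hU, Finset.mem_biUnion] at hx
    simp only [Finset.mem_biUnion, Finset.mem_insert, Finset.mem_erase]
    rcases hx with ⟨⟨l, hl, hxl⟩, hxj⟩ | ⟨hxi, -⟩
    · exact ⟨l, Or.inr ⟨by rintro rfl; exact hxj hxl, hl⟩, hxl⟩
    · exact ⟨i, Or.inl rfl, hxi⟩
  have hdis : Disjoint (U \ S.set j) (S.set i \ U) :=
    Finset.disjoint_left.2 fun x hx hx' => by simp_all
  have h1 := Finset.card_le_card hsub
  rw [Finset.card_union_of_disjoint hdis] at h1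
  have h2 := Finset.le_card_sdiff (S.set j) U
  have h3 := Finset.card_sdiff_add_card_inter (S.set i) U
  simp only [coverage, ← hU]
  omega

/-- A solution can be moved into a family `P` that contains the largest sets, at a loss of at most
`r * opt / K` for each set that has to be exchanged. -/
theorem exists_subset_coverage (S : SetStream n m) {r K k : ℕ}
    (hr : ∀ x, S.multiplicity x ≤ r) (hK : 0 < K) (P : Finset (Fin m))
    (hP : ∀ j ∉ P, K ≤ P.card ∧ ∀ i ∈ P, (S.set j).card ≤ (S.set i).card) (q : ℕ) :
    ∀ I : Finset (Fin m), I.card ≤ k → (I \ P).card = q →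
      ∃ I' ⊆ P, I'.card ≤ I.card ∧ K * S.coverage I ≤ K * S.coverage I' + q * (r * S.opt k) := by
  induction q with
  | zero =>
    intro I _ h
    exact ⟨I, Finset.sdiff_eq_empty_iff_subset.1 (Finset.card_eq_zero.1 h), le_rfl, by simp⟩
  | succ q ih =>
    intro I hI h
    obtain ⟨j, hj⟩ : (I \ P).Nonempty := Finset.card_pos.1 (by omega)
    obtain ⟨hjI, hjP⟩ := Finset.mem_sdiff.1 hj
    obtain ⟨hPK, hlarge⟩ := hP j hjP
    obtain ⟨i, hi, hsmall⟩ := S.exists_card_inter_le hr P hK hPK (I.biUnion S.set)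
    have hcard : (insert i (I.erase j)).card ≤ I.card := by
      have h1 := Finset.card_insert_le i (I.erase j)
      have h2 := Finset.card_erase_add_one hjI
      omega
    have hsd : insert i (I.erase j) \ P = (I \ P).erase j := by
      ext x
      simp only [Finset.mem_sdiff, Finset.mem_insert, Finset.mem_erase]
      constructor
      · rintro ⟨rfl | ⟨h1, h2⟩, h3⟩
        · exact absurd hi h3
        · exact ⟨h1, h2, h3⟩
      · rintro ⟨h1, h2, h3⟩
        exact ⟨Or.inr ⟨h1, h2⟩, h3⟩
    obtain ⟨I', hI'P, hI'c, hcov⟩ := ih (insert i (I.erase j)) (hcard.trans hI) (by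
      rw [hsd, Finset.card_erase_of_mem hj]; omega)
    refine ⟨I', hI'P, hI'c.trans hcard, ?_⟩
    -- Every intermediate solution has at most `k` sets, so each loss is charged to the fixed `opt`
    -- and the losses simply add up.
    have h1 := Nat.mul_le_mul_left K (S.coverage_exchange I (hlarge i hi))
    have h2 : r * (I.biUnion S.set).card ≤ r * S.opt k :=
      Nat.mul_le_mul_left r (S.coverage_le_opt hI)
    rw [Nat.mul_add] at h1
    rw [add_one_mul]
    omega

/-- If `P` contains the `K ≥ rk/η` largest sets, then some `k` sets of `P` cover at least
`(1 - η) opt`. -/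
theorem exists_large_coverage (S : SetStream n m) {r K k : ℕ} {η : ℝ}
    (hr : ∀ x, S.multiplicity x ≤ r) (hK : 0 < K) (hη : (r : ℝ) * k ≤ η * K)
    (P : Finset (Fin m)) (hkP : k ≤ P.card)
    (hP : ∀ j ∉ P, K ≤ P.card ∧ ∀ i ∈ P, (S.set j).card ≤ (S.set i).card) :
    ∃ I ∈ P.powersetCard k, (1 - η) * S.opt k ≤ S.coverage I := by
  obtain ⟨I, hI, hopt⟩ := S.exists_coverage_eq_opt k
  obtain ⟨I', hI'P, hI'c, hcov⟩ := S.exists_subset_coverage hr hK P hP _ I hI rfl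
  -- Padding to exactly `k` sets: the algorithm compares only `k`-subsets of the store.
  obtain ⟨J, hIJ, hJP, hJ⟩ := Finset.exists_subsuperset_card_eq hI'P (hI'c.trans hI) hkP
  refine ⟨J, Finset.mem_powersetCard.2 ⟨hJP, hJ⟩, ?_⟩
  have h1 : K * S.opt k ≤ K * S.coverage J + k * (r * S.opt k) := by
    have h2 := Nat.mul_le_mul_left K (S.coverage_mono hIJ)
    have h3 := Nat.mul_le_mul_right (r * S.opt k)
      ((Finset.card_le_card (Finset.sdiff_subset (s := I) (t := P))).trans hI)
    rw [hopt] at hcov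
    omega
  have h2 : (K : ℝ) * S.opt k ≤ K * S.coverage J + k * (r * S.opt k) := by exact_mod_cast h1
  have h3 := mul_le_mul_of_nonneg_right hη (Nat.cast_nonneg (α := ℝ) (S.opt k))
  have hK' : (0 : ℝ) < K := by exact_mod_cast hK
  refine le_of_mul_le_mul_left ?_ hK'
  nlinarith

end SetStream

/-! ### The run of the algorithm -/

variable {n m : ℕ}

theorem argmin_le {α β : Type} [LinearOrder β] (f : α → β) (T : Finset α) (h : T.Nonempty)
    {x : α} (hx : x ∈ T) : f (argmin f T h) ≤ f x :=
  (T.exists_min_image f h).choose_spec.2 x hx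

theorem argmax_mem {α β : Type} [LinearOrder β] (f : α → β) (T : Finset α) (h : T.Nonempty) :
    argmax f T h ∈ T :=
  (T.exists_max_image f h).choose_spec.1

theorem le_argmax {α β : Type} [LinearOrder β] (f : α → β) (T : Finset α) (h : T.Nonempty)
    {x : α} (hx : x ∈ T) : f x ≤ f (argmax f T h) :=
  (T.exists_max_image f h).choose_spec.2 x hx

/-- The memory after reading a stream with a given seed. -/
def finalMemory {K : ℕ} {Φ : SketchScheme n} (ω : Φ.Seed) (l : List (Token n)) :
    Memory n m K Φ :=
  l.foldl update (ω, (0, 0, Φ.empty ω), ⟨∅, by simp⟩)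

theorem runFrom_largestSets (K k : ℕ) (Φ : SketchScheme n) (l : List (Token n)) :
    ∀ s : Memory n m K Φ,
      (largestSets n m K k Φ).runFrom s l = PMF.pure (l.foldl update s) := by
  induction l with
  | nil => intro s; rfl
  | cons t l ih =>
    intro s
    have h : (largestSets n m K k Φ).runFrom s (t :: l)
        = (PMF.pure (update s t)).bind fun s' => (largestSets n m K k Φ).runFrom s' l := rfl
    rw [h, PMF.pure_bind]
    exact ih _

/-- When updates and answers are deterministic, all randomness sits in the initial draw, so events
about the answer become events about the seed. -/
theorem StreamAlgorithm.run_eq_map {Tok Out α : Type} (A : StreamAlgorithm Tok Out) (p : PMF α)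
    {g : α → A.State} {f : A.State → A.State} {o : A.State → Out} {l : List Tok}
    (hinit : A.init = p.bind fun x => PMF.pure (g x))
    (hrun : ∀ s, A.runFrom s l = PMF.pure (f s)) (hout : ∀ s, A.output s = PMF.pure (o s)) :
    A.run l = p.map fun x => o (f (g x)) := by
  unfold StreamAlgorithm.run
  rw [hinit, PMF.bind_bind, PMF.bind_bind, ← PMF.bind_pure_comp]
  congr 1
  funext x
  rw [PMF.pure_bind, hrun, PMF.pure_bind, hout]
  rfl

theorem run_largestSets (K k : ℕ) (Φ : SketchScheme n) (l : List (Token n)) :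
    (largestSets n m K k Φ).run l
      = Φ.seedDist.map fun ω => bestOf k (finalMemory (m := m) (K := K) ω l) :=
  (largestSets n m K k Φ).run_eq_map Φ.seedDist
    (g := fun ω => ((ω, (0, 0, Φ.empty ω), ⟨∅, by simp⟩) : Memory n m K Φ))
    (f := fun s : Memory n m K Φ => l.foldl update s)
    (o := fun s : Memory n m K Φ => bestOf k s)
    rfl (runFrom_largestSets K k Φ l) fun _ => rfl

/-- The record of the `j`-th set of a stream. -/
def recordOf (S : SetStream n m) (Φ : SketchScheme n) (ω : Φ.Seed) (j : Fin m) :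
    Record n m Φ.Sk :=
  (j, ⟨(S.elems j).length, by
    have := (S.nodup j).length_le_card
    simp only [Fintype.card_fin] at this
    omega⟩, Φ.sketch ω (S.elems j))

theorem recordOf_size (S : SetStream n m) (Φ : SketchScheme n) (ω : Φ.Seed) (j : Fin m) :
    ((recordOf S Φ ω j).2.1 : ℕ) = (S.set j).card :=
  (List.toFinset_card_of_nodup (S.nodup j)).symm

theorem recordOf_injective (S : SetStream n m) (Φ : SketchScheme n) (ω : Φ.Seed) :
    Function.Injective (recordOf S Φ ω) :=
  fun _ _ h => congrArg Prod.fst h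

theorem incr_mk {N c : ℕ} (h : c + 1 < N + 1) :
    incr (⟨c, by omega⟩ : Fin (N + 1)) = ⟨c + 1, h⟩ := by
  simp [incr, h]

/-- The hypothesis `h` keeps the size counter from saturating. -/
theorem foldl_update_elems {K : ℕ} {Φ : SketchScheme n} (ω : Φ.Seed) (i : Fin (m + 1))
    (T : Store n m K Φ.Sk) (l : List (Fin n)) :
    ∀ (c : ℕ) (σ : Φ.Sk) (h : c + l.length < n + 1),
      (l.map Token.elem).foldl update ((ω, (i, ⟨c, by omega⟩, σ), T) : Memory n m K Φ)
        = (ω, (i, ⟨c + l.length, h⟩, l.foldl (Φ.add ω) σ), T) := by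
  induction l with
  | nil => intro c σ h; rfl
  | cons x l ih =>
    intro c σ h
    rw [List.length_cons] at h
    rw [List.map_cons, List.foldl_cons, List.foldl_cons]
    have h1 : update ((ω, (i, ⟨c, by omega⟩, σ), T) : Memory n m K Φ) (Token.elem x)
        = (ω, (i, ⟨c + 1, by omega⟩, Φ.add ω σ x), T) := by
      simp only [update]
      rw [incr_mk (by omega)]
    rw [h1, ih (c + 1) _ (by omega)]
    simp [add_assoc, add_comm 1]

theorem foldl_update_set {K : ℕ} {Φ : SketchScheme n} (S : SetStream n m) (ω : Φ.Seed)
    (j : Fin m) (T : Store n m K Φ.Sk) :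
    ((S.elems j).map Token.elem ++ [Token.endSet]).foldl update
        ((ω, (j.castSucc, 0, Φ.empty ω), T) : Memory n m K Φ)
      = (ω, (j.succ, 0, Φ.empty ω), T.put (recordOf S Φ ω j)) := by
  have hlen := (recordOf S Φ ω j).2.1.2
  have h0 : 0 + (S.elems j).length < n + 1 := by rw [zero_add]; exact hlen
  rw [List.foldl_append]
  erw [foldl_update_elems ω j.castSucc T (S.elems j) 0 (Φ.empty ω) h0]
  have hincr : incr j.castSucc = j.succ := incr_mk (c := (j : ℕ)) (by omega)
  simp only [List.foldl_cons, List.foldl_nil, update, hincr, Fin.val_castSucc, Fin.is_lt,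
    dite_true, recordOf, SketchScheme.sketch, zero_add]

/-- The store holds records of the largest of the first `i` sets. -/
def HoldsLargest {K : ℕ} {Φ : SketchScheme n} (S : SetStream n m) (ω : Φ.Seed) (i : ℕ)
    (T : Store n m K Φ.Sk) : Prop :=
  (∀ ρ ∈ T.1, (ρ.1 : ℕ) < i ∧ ρ = recordOf S Φ ω ρ.1) ∧
    ∀ j : Fin m, (j : ℕ) < i → recordOf S Φ ω j ∉ T.1 →
      T.1.card = K ∧ ∀ ρ ∈ T.1, (recordOf S Φ ω j).2.1 ≤ ρ.2.1

/-- A store with a missing set is full, and evicting a smallest record keeps it full. An older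
missing set is no larger than any old record. -/
theorem HoldsLargest.put {K : ℕ} {Φ : SketchScheme n} {S : SetStream n m} {ω : Φ.Seed}
    {j : Fin m} {T : Store n m K Φ.Sk} (h : HoldsLargest S ω j T) :
    HoldsLargest S ω (j + 1) (T.put (recordOf S Φ ω j)) := by
  obtain ⟨h1, h2⟩ := h
  have hins : ∀ ρ ∈ insert (recordOf S Φ ω j) T.1,
      (ρ.1 : ℕ) < j + 1 ∧ ρ = recordOf S Φ ω ρ.1 := by
    intro ρ hρ
    rcases Finset.mem_insert.1 hρ with rfl | hρ
    · exact ⟨Nat.lt_succ_self _, rfl⟩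
    · exact ⟨(h1 ρ hρ).1.trans (Nat.lt_succ_self _), (h1 ρ hρ).2⟩
  have hnew : recordOf S Φ ω j ∉ T.1 := fun hmem => lt_irrefl _ (h1 _ hmem).1
  have hci := Finset.card_insert_of_notMem hnew
  have hTK := T.2
  unfold Store.put
  split_ifs with hK
  · refine ⟨hins, fun i hi hmem => ?_⟩
    exfalso
    simp only [Finset.mem_insert, not_or] at hmem
    rcases Nat.lt_succ_iff_lt_or_eq.1 hi with hlt | heq
    · have := (h2 i hlt hmem.2).1
      omega
    · exact hmem.1 (by rw [Fin.ext heq])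
  · have hmin := argmin_mem (fun σ : Record n m Φ.Sk => σ.2.1) _
      (Finset.insert_nonempty (recordOf S Φ ω j) T.1)
    have hle := fun ρ => argmin_le (x := ρ) (fun σ : Record n m Φ.Sk => σ.2.1) _
      (Finset.insert_nonempty (recordOf S Φ ω j) T.1)
    refine ⟨fun ρ hρ => hins ρ (Finset.mem_of_mem_erase hρ), fun i hi hmem => ⟨?_, ?_⟩⟩
    · simp only [Finset.card_erase_of_mem hmin]
      omega
    · intro ρ hρ
      have hρ' := Finset.mem_of_mem_erase hρ
      by_cases hin : recordOf S Φ ω i ∈ insert (recordOf S Φ ω j) T.1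
      · have heq : recordOf S Φ ω i = argmin (fun σ : Record n m Φ.Sk => σ.2.1) _
            (Finset.insert_nonempty (recordOf S Φ ω j) T.1) := by
          by_contra hne
          exact hmem (Finset.mem_erase.2 ⟨hne, hin⟩)
        rw [heq]
        exact hle ρ hρ'
      · simp only [Finset.mem_insert, not_or] at hin
        have hlt : (i : ℕ) < j := by
          rcases Nat.lt_succ_iff_lt_or_eq.1 hi with hlt | heq
          · exact hlt
          · exact absurd (by rw [Fin.ext heq]) hin.1
        have hold := (h2 i hlt hin.2).2
        rcases Finset.mem_insert.1 hρ' with rfl | hρT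
        -- Comparison with the new record goes through the evicted one: an old record, at least as
        -- large as the missing set and at most as large as the new one.
        · by_cases hT : (argmin (fun σ : Record n m Φ.Sk => σ.2.1) _
            (Finset.insert_nonempty (recordOf S Φ ω j) T.1)) ∈ T.1
          · exact (hold _ hT).trans (hle _ hρ')
          · have heq := (Finset.mem_insert.1 hmin).resolve_right hT
            exact absurd heq.symm (Finset.mem_erase.1 hρ).1
        · exact hold ρ hρT

theorem finalMemory_tokens (K : ℕ) (Φ : SketchScheme n) (S : SetStream n m) (ω : Φ.Seed) :
    ∃ (τ : Fin (m + 1) × Fin (n + 1) × Φ.Sk) (T : Store n m K Φ.Sk),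
      (finalMemory ω S.tokens : Memory n m K Φ) = (ω, τ, T) ∧ HoldsLargest S ω m T := by
  have key : ∀ i (hi : i ≤ m), ∃ T : Store n m K Φ.Sk,
      (((List.finRange m).take i).flatMap fun i =>
          (S.elems i).map Token.elem ++ [Token.endSet]).foldl update
        ((ω, (0, 0, Φ.empty ω), ⟨∅, by simp⟩) : Memory n m K Φ)
          = (ω, (⟨i, by omega⟩, 0, Φ.empty ω), T) ∧ HoldsLargest S ω i T := by
    intro i
    induction i with
    | zero =>
      intro _
      exact ⟨⟨∅, by simp⟩, rfl, by simp [HoldsLargest]⟩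
    | succ i ih =>
      intro hi
      obtain ⟨T, hT, hL⟩ := ih (by omega)
      refine ⟨T.put (recordOf S Φ ω ⟨i, by omega⟩), ?_, HoldsLargest.put (j := ⟨i, by omega⟩) hL⟩
      rw [List.take_succ_eq_append_getElem (by simpa using hi), List.flatMap_append,
        List.foldl_append, hT, List.getElem_finRange, List.flatMap_singleton]
      exact foldl_update_set S ω ⟨i, by omega⟩ T
  obtain ⟨T, hT, hL⟩ := key m le_rfl
  rw [List.take_of_length_le (by simp)] at hT
  exact ⟨_, T, hT, hL⟩

/-! ### Correctness -/

theorem distinct_eq_coverage (S : SetStream n m) (I : Finset (Fin m)) :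
    SketchScheme.distinct (I.val.map S.elems) = S.coverage I := by
  unfold SketchScheme.distinct SetStream.coverage
  congr 1
  ext x
  simp [SetStream.set]

/-- The seed estimates the coverage of the sets with index in `I` up to relative error `η`. -/
def Accurate (S : SetStream n m) (Φ : SketchScheme n) (η : ℝ) (I : Finset (Fin m))
    (ω : Φ.Seed) : Prop :=
  |Φ.estimate ω ((I.val.map S.elems).map (Φ.sketch ω))
    - SketchScheme.distinct (I.val.map S.elems)|
      ≤ η * SketchScheme.distinct (I.val.map S.elems)

/-- The chosen family is estimated at least as high as the good family supplied by
`exists_large_coverage`; accuracy for both turns this into a comparison of true coverages. -/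
theorem isApprox_bestOf {K k r : ℕ} {Φ : SketchScheme n} (S : SetStream n m) (ω : Φ.Seed)
    {η : ℝ} (hη0 : 0 < η) (hη : η ≤ 1 / 6) (hr : ∀ x, S.multiplicity x ≤ r)
    (hkm : k ≤ m) (hkK : k ≤ K) (hK : 0 < K) (hrk : (r : ℝ) * k ≤ η * K)
    (hacc : ∀ I ∈ (Finset.univ : Finset (Fin m)).powersetCard k, Accurate S Φ η I ω) :
    S.IsApprox k (1 + 6 * η) (bestOf k (finalMemory ω S.tokens : Memory n m K Φ)) := by
  obtain ⟨τ, T, hmem, h1, h2⟩ := finalMemory_tokens K Φ S ω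
  rw [hmem]
  -- For a fixed seed a stored record is determined by its index, so families of records and
  -- families of indices can be interchanged.
  have himg : ∀ J ⊆ T.1, (J.image Prod.fst).image (recordOf S Φ ω) = J := by
    intro J hJ
    rw [Finset.image_image]
    refine (Finset.image_congr fun ρ hρ => ?_).trans Finset.image_id
    exact ((h1 ρ (hJ hρ)).2).symm
  have hcardimg : ∀ J ⊆ T.1, (J.image Prod.fst).card = J.card := by
    intro J hJ
    conv_rhs => rw [← himg J hJ]
    rw [Finset.card_image_of_injective _ (recordOf_injective S Φ ω)]
  have hest : ∀ I : Finset (Fin m), estimatedCoverage Φ ω (I.image (recordOf S Φ ω))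
      = Φ.estimate ω ((I.val.map S.elems).map (Φ.sketch ω)) := by
    intro I
    unfold estimatedCoverage
    rw [Finset.image_val_of_injOn (recordOf_injective S Φ ω).injOn, Multiset.map_map,
      Multiset.map_map]
    rfl
  set P := T.1.image Prod.fst with hPdef
  have hPT : P.image (recordOf S Φ ω) = T.1 := himg _ subset_rfl
  have hPcard : P.card = T.1.card := hcardimg _ subset_rfl
  have hmiss : ∀ j ∉ P, recordOf S Φ ω j ∉ T.1 := fun j hj hjT =>
    hj (Finset.mem_image.2 ⟨_, hjT, rfl⟩)
  have hP : ∀ j ∉ P, K ≤ P.card ∧ ∀ i ∈ P, (S.set j).card ≤ (S.set i).card := by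
    intro j hj
    obtain ⟨h3, h4⟩ := h2 j j.2 (hmiss j hj)
    refine ⟨by omega, fun i hi => ?_⟩
    have h5 := h4 _ (by rw [← hPT]; exact Finset.mem_image_of_mem _ hi)
    rw [← recordOf_size S Φ ω, ← recordOf_size S Φ ω]
    exact h5
  have hkP : k ≤ P.card := by
    by_cases hall : ∀ j, j ∈ P
    · rw [Finset.eq_univ_iff_forall.2 hall]
      simpa using hkm
    · push Not at hall
      obtain ⟨j, hj⟩ := hall
      exact hkK.trans (hP j hj).1
  have hne : (T.1.powersetCard k).Nonempty :=
    Finset.powersetCard_nonempty.2 (hPcard ▸ hkP)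
  have hbest : bestOf k ((ω, τ, T) : Memory n m K Φ)
      = (argmax (estimatedCoverage Φ ω) (T.1.powersetCard k) hne).image Prod.fst := by
    simp only [bestOf, hne, dite_true]
  rw [hbest]
  obtain ⟨I, hI, hIcov⟩ := S.exists_large_coverage hr hK hrk P hkP hP
  obtain ⟨hIP, hIk⟩ := Finset.mem_powersetCard.1 hI
  have hmax := le_argmax (estimatedCoverage Φ ω) (T.1.powersetCard k) hne
    (x := I.image (recordOf S Φ ω)) (by
      rw [Finset.mem_powersetCard, ← hPT]
      exact ⟨Finset.image_subset_image hIP, by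
        rw [Finset.card_image_of_injective _ (recordOf_injective S Φ ω), hIk]⟩)
  obtain ⟨hJT, hJk⟩ := Finset.mem_powersetCard.1
    (argmax_mem (estimatedCoverage Φ ω) (T.1.powersetCard k) hne)
  set J := argmax (estimatedCoverage Φ ω) (T.1.powersetCard k) hne
  rw [← himg J hJT, hest, hest] at hmax
  have hJc : (J.image Prod.fst).card = k := (hcardimg J hJT).trans hJk
  have haI := hacc I (Finset.mem_powersetCard.2 ⟨Finset.subset_univ _, hIk⟩)
  have haJ := hacc (J.image Prod.fst) (Finset.mem_powersetCard.2 ⟨Finset.subset_univ _, hJc⟩)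
  refine ⟨hJc.le, ?_⟩
  unfold Accurate at haI haJ
  rw [distinct_eq_coverage] at haI haJ
  rw [abs_le] at haI haJ
  have hO : (0 : ℝ) ≤ S.opt k := Nat.cast_nonneg _
  have e1 : (1 - η) * ((1 - η) * S.opt k) ≤ (1 - η) * S.coverage I :=
    mul_le_mul_of_nonneg_left hIcov (by linarith)
  have e2 : (1 - η) * ((1 - η) * S.opt k) ≤ (1 + η) * S.coverage (J.image Prod.fst) := by
    linarith [haI.1, haJ.2]
  have e3 : (1 + η) * (S.opt k : ℝ) ≤ (1 + 6 * η) * ((1 - η) * ((1 - η) * S.opt k)) := by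
    -- The difference of the two sides is `η(3 - 11η + 6η²)`, nonnegative for `η ≤ 1/6`.
    have h : 1 + η ≤ (1 + 6 * η) * ((1 - η) * (1 - η)) := by
      nlinarith [mul_nonneg hη0.le (sub_nonneg.2 hη), mul_nonneg hη0.le (sq_nonneg η)]
    have := mul_le_mul_of_nonneg_right h hO
    linarith
  have e4 := mul_le_mul_of_nonneg_left e2 (by linarith : (0 : ℝ) ≤ 1 + 6 * η)
  refine le_of_mul_le_mul_left ?_ (by linarith : (0 : ℝ) < 1 + η)
  linarith

/-- The union bound runs over all `k`-subsets of the stream, not of the store: tie-breaking sees the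
sketches, so the stored family may depend on the seed. -/
theorem prob_not_isApprox_le {K k r : ℕ} {Φ : SketchScheme n} (S : SetStream n m)
    {η δ : ℝ} (hη0 : 0 < η) (hη : η ≤ 1 / 6) (hr : ∀ x, S.multiplicity x ≤ r)
    (hkm : k ≤ m) (hkK : k ≤ K) (hK : 0 < K) (hrk : (r : ℝ) * k ≤ η * K)
    (hΦ : Φ.IsF0Sketch η δ) :
    prob ((largestSets n m K k Φ).run S.tokens) {I | ¬ S.IsApprox k (1 + 6 * η) I}
      ≤ m.choose k * δ := by
  rw [run_largestSets, prob_map]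
  calc _ ≤ prob Φ.seedDist (⋃ I ∈ (Finset.univ : Finset (Fin m)).powersetCard k,
          {ω | ¬ Accurate S Φ η I ω}) := by
        refine prob_mono _ fun ω hω => ?_
        by_contra hcon
        simp only [Set.mem_iUnion, Set.mem_ofPred_eq, not_exists, not_not] at hcon
        exact hω (isApprox_bestOf S ω hη0 hη hr hkm hkK hK hrk hcon)
    _ ≤ ∑ I ∈ (Finset.univ : Finset (Fin m)).powersetCard k,
          prob Φ.seedDist {ω | ¬ Accurate S Φ η I ω} := prob_biUnion_le _ _ _
    _ ≤ ∑ I ∈ (Finset.univ : Finset (Fin m)).powersetCard k, δ :=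
        Finset.sum_le_sum fun I _ => hΦ _
    _ = m.choose k * δ := by simp

/-! ### Threshold sketches -/

section Threshold

variable {n : ℕ}

/-- The largest `θ ≤ N` such that at most `s` elements of `A` have hash value below `θ`. -/
def threshold (h : Fin n → ℕ) (s N : ℕ) (A : Finset (Fin n)) : ℕ :=
  Nat.findGreatest (fun θ => (A.filter fun x => h x < θ).card ≤ s) N

theorem threshold_le (h : Fin n → ℕ) (s N : ℕ) (A : Finset (Fin n)) :
    threshold h s N A ≤ N :=
  Nat.findGreatest_le N

theorem card_filter_threshold_le (h : Fin n → ℕ) (s N : ℕ) (A : Finset (Fin n)) :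
    (A.filter fun x => h x < threshold h s N A).card ≤ s :=
  Nat.findGreatest_spec (P := fun θ => (A.filter fun x => h x < θ).card ≤ s)
    (Nat.zero_le N) (by simp)

theorem le_threshold {h : Fin n → ℕ} {s N θ : ℕ} {A : Finset (Fin n)} (hθ : θ ≤ N)
    (hA : (A.filter fun x => h x < θ).card ≤ s) : θ ≤ threshold h s N A :=
  Nat.le_findGreatest hθ hA

theorem lt_card_filter {h : Fin n → ℕ} {s N θ : ℕ} {A : Finset (Fin n)}
    (hA : threshold h s N A < θ) (hθ : θ ≤ N) :
    s < (A.filter fun x => h x < θ).card := by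
  by_contra hcon
  exact absurd (le_threshold hθ (not_lt.1 hcon)) (not_le.2 hA)

theorem threshold_anti (h : Fin n → ℕ) (s N : ℕ) {A B : Finset (Fin n)} (hAB : A ⊆ B) :
    threshold h s N B ≤ threshold h s N A :=
  le_threshold (threshold_le h s N B)
    ((Finset.card_le_card (Finset.filter_subset_filter _ hAB)).trans
      (card_filter_threshold_le h s N B))

/-- A threshold sketch: a threshold, and at most `s` elements. -/
abbrev ThresholdSketch (n s N : ℕ) : Type := Fin (N + 1) × {T : Finset (Fin n) // T.card ≤ s}

/-- Lower the threshold until at most `s` elements of `U` remain. -/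
def shrink (h : Fin n → ℕ) (s : ℕ) {N : ℕ} (θ : Fin (N + 1)) (U : Finset (Fin n)) :
    ThresholdSketch n s N :=
  (⟨threshold h s θ U, (threshold_le h s θ U).trans_lt θ.2⟩,
    ⟨U.filter fun x => h x < threshold h s θ U, card_filter_threshold_le h s θ U⟩)

/-- The threshold sketch of a set. -/
def sketchOf (h : Fin n → ℕ) (s N : ℕ) (A : Finset (Fin n)) : ThresholdSketch n s N :=
  shrink h s (Fin.last N) A

theorem mem_sketchOf {h : Fin n → ℕ} {s N : ℕ} {A : Finset (Fin n)} {x : Fin n} :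
    x ∈ (sketchOf h s N A).2.1 ↔ x ∈ A ∧ h x < (sketchOf h s N A).1 := by
  simp [sketchOf, shrink]

theorem sketchOf_fst (h : Fin n → ℕ) (s N : ℕ) (A : Finset (Fin n)) :
    ((sketchOf h s N A).1 : ℕ) = threshold h s N A := rfl

/-- A sketch only depends on the elements below a bound for the threshold. -/
theorem shrink_eq_sketchOf {h : Fin n → ℕ} {s N : ℕ} {A U : Finset (Fin n)} {θ : Fin (N + 1)}
    (hθ : threshold h s N A ≤ θ) (hU : ∀ x, h x < θ → (x ∈ U ↔ x ∈ A)) :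
    shrink h s θ U = sketchOf h s N A := by
  have hfil : ∀ τ : ℕ, τ ≤ θ → (U.filter fun x => h x < τ) = A.filter fun x => h x < τ := by
    intro τ hτ
    ext x
    simp only [Finset.mem_filter]
    exact and_congr_left fun hx => hU x (hx.trans_le hτ)
  have hthr : threshold h s θ U = threshold h s N A := by
    apply le_antisymm
    · refine le_threshold ((threshold_le _ _ _ _).trans (Nat.lt_succ_iff.1 θ.2)) ?_
      rw [← hfil _ (threshold_le _ _ _ _)]
      exact card_filter_threshold_le _ _ _ _
    · refine le_threshold hθ ?_
      rw [hfil _ hθ]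
      exact card_filter_threshold_le _ _ _ _
  refine Prod.ext (Fin.ext hthr) (Subtype.ext ?_)
  change (U.filter fun x => h x < threshold h s θ U) = A.filter fun x => h x < threshold h s N A
  rw [hthr, hfil _ hθ]

/-- Add an element to a threshold sketch. -/
def addElem (h : Fin n → ℕ) {s N : ℕ} (σ : ThresholdSketch n s N) (x : Fin n) :
    ThresholdSketch n s N :=
  shrink h s σ.1 (insert x σ.2.1)

/-- Thresholds only decrease as the set grows, so a discarded element is never needed again. Hence a
sketch depends on the set alone, not on order or repetition. -/
theorem addElem_sketchOf (h : Fin n → ℕ) (s N : ℕ) (A : Finset (Fin n)) (x : Fin n) :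
    addElem h (sketchOf h s N A) x = sketchOf h s N (insert x A) := by
  refine shrink_eq_sketchOf (threshold_anti h s N (Finset.subset_insert x A)) fun y hy => ?_
  rw [Finset.mem_insert, Finset.mem_insert, mem_sketchOf]
  tauto

theorem foldl_addElem (h : Fin n → ℕ) (s N : ℕ) (l : List (Fin n)) :
    ∀ A, l.foldl (addElem h) (sketchOf h s N A) = sketchOf h s N (A ∪ l.toFinset) := by
  induction l with
  | nil => intro A; simp
  | cons x l ih =>
    intro A
    rw [List.foldl_cons, addElem_sketchOf, ih]
    congr 1
    ext y
    simp only [Finset.mem_union, Finset.mem_insert, List.toFinset_cons]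
    tauto

/-- The elements of the sketches of a collection. -/
def keptElems {s N : ℕ} (M : Multiset (ThresholdSketch n s N)) : Finset (Fin n) :=
  Finset.univ.filter fun x => ∃ σ ∈ M, x ∈ σ.2.1

/-- Merge a collection of threshold sketches. -/
def merge (h : Fin n → ℕ) {s N : ℕ} (M : Multiset (ThresholdSketch n s N)) :
    ThresholdSketch n s N :=
  shrink h s (M.map Prod.fst).inf (keptElems M)

/-- The elements of a collection of listed sets. -/
def unionOf (C : Multiset (List (Fin n))) : Finset (Fin n) :=
  Finset.univ.filter fun x => ∃ l ∈ C, x ∈ l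

/-- The threshold of the union is at most each individual one, and below their minimum every sketch
still has all elements of its set. For the empty collection the infimum is the top value `N`. -/
theorem merge_sketchOf (h : Fin n → ℕ) (s N : ℕ) (C : Multiset (List (Fin n))) :
    merge h (C.map fun l => sketchOf h s N l.toFinset) = sketchOf h s N (unionOf C) := by
  refine shrink_eq_sketchOf ?_ fun x hx => ?_
  · change (sketchOf h s N (unionOf C)).1 ≤ _
    rw [Multiset.le_inf]
    intro θ hθ
    simp only [Multiset.map_map, Multiset.mem_map, Function.comp] at hθ
    obtain ⟨l, hl, rfl⟩ := hθ
    refine threshold_anti h s N fun x hx => ?_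
    simp only [unionOf, Finset.mem_filter, Finset.mem_univ, true_and]
    exact ⟨l, hl, List.mem_toFinset.1 hx⟩
  · simp only [keptElems, unionOf, Finset.mem_filter, Finset.mem_univ, true_and,
      Multiset.mem_map, exists_exists_and_eq_and, mem_sketchOf, List.mem_toFinset]
    refine exists_congr fun l => and_congr_right fun hl => and_iff_left_of_imp fun _ => ?_
    refine hx.trans_le (Multiset.inf_le ?_ : (_ : Fin (N + 1)) ≤ _)
    rw [Multiset.map_map]
    exact Multiset.mem_map.2 ⟨l, hl, rfl⟩

/-- The number of elements as estimated from a threshold sketch. -/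
def sizeEstimate {s N : ℕ} (σ : ThresholdSketch n s N) : ℝ :=
  -- When all hash values are below `N`, threshold `N` means nothing was discarded and the count is
  -- exact. At threshold `0` the quotient is `0` by convention.
  if (σ.1 : ℕ) = N then σ.2.1.card else s * N / (σ.1 : ℕ)

end Threshold

/-! ### Affine hash functions -/

section Affine

variable {p : ℕ} [Fact p.Prime] {n : ℕ}

/-- The hash function `x ↦ a x + b` modulo `p`. -/
def affineHash (ω : ZMod p × ZMod p) (x : Fin n) : ℕ :=
  (ω.1 * ((x : ℕ) : ZMod p) + ω.2).val

theorem affineHash_lt (ω : ZMod p × ZMod p) (x : Fin n) : affineHash ω x < p :=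
  ZMod.val_lt _

theorem card_val_lt {θ : ℕ} (hθ : θ ≤ p) :
    (Finset.univ.filter fun y : ZMod p => y.val < θ).card = θ := by
  conv_rhs => rw [← Finset.card_range θ]
  refine Finset.card_bij (fun y _ => y.val) (fun y hy => by simpa using hy)
    (fun y _ z _ h => ZMod.val_injective p h) fun c hc => ?_
  have hc' := Finset.mem_range.1 hc
  exact ⟨(c : ZMod p), by simp [ZMod.val_cast_of_lt (hc'.trans_le hθ), hc'],
    ZMod.val_cast_of_lt (hc'.trans_le hθ)⟩

/-- The random shift makes a single hash value uniform: `(a, b) ↦ (a, ax + b)` is a bijection. -/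
theorem card_affineHash_lt {θ : ℕ} (hθ : θ ≤ p) (x : Fin n) :
    (Finset.univ.filter fun ω : ZMod p × ZMod p => affineHash ω x < θ).card = p * θ := by
  have h : ((Finset.univ : Finset (ZMod p)) ×ˢ
      Finset.univ.filter fun y : ZMod p => y.val < θ).card = p * θ := by
    rw [Finset.card_product, card_val_lt hθ, Finset.card_univ, ZMod.card]
  rw [← h]
  refine Finset.card_bij' (fun ω _ => (ω.1, ω.1 * ((x : ℕ) : ZMod p) + ω.2))
    (fun ω _ => (ω.1, ω.2 - ω.1 * ((x : ℕ) : ZMod p))) ?_ ?_ ?_ ?_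
  · exact fun ω hω => Finset.mem_product.2 ⟨Finset.mem_univ _,
      Finset.mem_filter.2 ⟨Finset.mem_univ _, (Finset.mem_filter.1 hω).2⟩⟩
  · intro ω hω
    refine Finset.mem_filter.2 ⟨Finset.mem_univ _, ?_⟩
    rw [affineHash, add_sub_cancel]
    exact (Finset.mem_filter.1 (Finset.mem_product.1 hω).2).2
  · intro ω _; simp
  · intro ω _; simp

theorem natCast_sub_ne_zero (hn : n ≤ p) {x y : Fin n} (hxy : x ≠ y) :
    ((x : ℕ) : ZMod p) - ((y : ℕ) : ZMod p) ≠ 0 := by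
  intro h
  apply hxy
  have h1 := congrArg ZMod.val (sub_eq_zero.1 h)
  rw [ZMod.val_cast_of_lt (x.2.trans_le hn), ZMod.val_cast_of_lt (y.2.trans_le hn)] at h1
  exact Fin.ext h1

/-- Pairwise independence: `(a, b) ↦ (ax + b, ay + b)` is a bijection, since `x - y` is invertible
modulo `p` when `n ≤ p`. -/
theorem card_affineHash_pair_lt (hn : n ≤ p) {θ : ℕ} (hθ : θ ≤ p) {x y : Fin n} (hxy : x ≠ y) :
    (Finset.univ.filter fun ω : ZMod p × ZMod p =>
      affineHash ω x < θ ∧ affineHash ω y < θ).card = θ * θ := by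
  have h : ((Finset.univ.filter fun y : ZMod p => y.val < θ) ×ˢ
      Finset.univ.filter fun y : ZMod p => y.val < θ).card = θ * θ := by
    rw [Finset.card_product, card_val_lt hθ]
  rw [← h]
  have hne := natCast_sub_ne_zero hn hxy
  set X : ZMod p := ((x : ℕ) : ZMod p) with hX
  set Y : ZMod p := ((y : ℕ) : ZMod p) with hY
  have e1 : ∀ u v : ZMod p, (u - v) / (X - Y) * X + (u - (u - v) / (X - Y) * X) = u := by
    intro u v; ring
  have e2 : ∀ u v : ZMod p, (u - v) / (X - Y) * Y + (u - (u - v) / (X - Y) * X) = v := by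
    intro u v; field_simp; ring
  refine Finset.card_bij' (fun ω _ => (ω.1 * X + ω.2, ω.1 * Y + ω.2))
    (fun q _ => ((q.1 - q.2) / (X - Y), q.1 - (q.1 - q.2) / (X - Y) * X)) ?_ ?_ ?_ ?_
  · intro ω hω; simpa [affineHash, ← hX, ← hY] using hω
  · intro q hq
    simp only [Finset.mem_filter, Finset.mem_univ, true_and, affineHash, ← hX, ← hY, e1, e2]
    simpa using hq
  · intro ω _
    have : (ω.1 * X + ω.2 - (ω.1 * Y + ω.2)) / (X - Y) = ω.1 := by
      rw [div_eq_iff hne]; ring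
    simp only [this]
    ext <;> simp
  · intro q _
    simp only [e1, e2]

/-- The number of elements of `A` with hash value below `θ`. -/
def countBelow (A : Finset (Fin n)) (θ : ℕ) (ω : ZMod p × ZMod p) : ℕ :=
  (A.filter fun x => affineHash ω x < θ).card

theorem sum_countBelow (A : Finset (Fin n)) {θ : ℕ} (hθ : θ ≤ p) :
    ∑ ω : ZMod p × ZMod p, countBelow A θ ω = A.card * (p * θ) := by
  simp only [countBelow, Finset.card_filter]
  rw [Finset.sum_comm]
  simp only [← Finset.card_filter, card_affineHash_lt hθ, Finset.sum_const, smul_eq_mul]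

theorem sum_countBelow_sq_le (hn : n ≤ p) (A : Finset (Fin n)) {θ : ℕ} (hθ : θ ≤ p) :
    ∑ ω : ZMod p × ZMod p, countBelow A θ ω ^ 2
      ≤ A.card * (p * θ) + A.card ^ 2 * θ ^ 2 := by
  have h : ∀ ω : ZMod p × ZMod p, countBelow A θ ω ^ 2
      = ∑ x ∈ A, ∑ y ∈ A, if affineHash ω x < θ ∧ affineHash ω y < θ then 1 else 0 := by
    intro ω
    rw [sq, countBelow, Finset.card_filter, Finset.sum_mul_sum]
    refine Finset.sum_congr rfl fun x _ => Finset.sum_congr rfl fun y _ => ?_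
    rw [ite_and]; split_ifs <;> rfl
  simp only [h]
  rw [Finset.sum_comm]
  have h2 : ∀ x ∈ A, ∑ ω : ZMod p × ZMod p, ∑ y ∈ A,
      (if affineHash ω x < θ ∧ affineHash ω y < θ then 1 else 0) ≤ p * θ + A.card * θ ^ 2 := by
    intro x hx
    rw [Finset.sum_comm, ← Finset.add_sum_erase _ _ hx]
    simp only [← Finset.card_filter, and_self]
    rw [card_affineHash_lt hθ]
    refine Nat.add_le_add_left ?_ _
    calc _ ≤ ∑ y ∈ A.erase x, θ ^ 2 := Finset.sum_le_sum fun y hy => by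
            rw [card_affineHash_pair_lt hn hθ (Finset.ne_of_mem_erase hy).symm, sq]
      _ = (A.erase x).card * θ ^ 2 := by simp
      _ ≤ _ := Nat.mul_le_mul_right _ (Finset.card_le_card (Finset.erase_subset _ _))
  refine (Finset.sum_le_sum h2).trans_eq ?_
  rw [Finset.sum_const, smul_eq_mul]
  ring

/-- For pairwise independent indicators the variance is at most the mean; both sides carry the
factor `p²`, the number of seeds. -/
theorem sum_sq_countBelow_sub_le (hn : n ≤ p) (A : Finset (Fin n)) {θ : ℕ} (hθ : θ ≤ p) :
    ∑ ω : ZMod p × ZMod p, ((countBelow A θ ω : ℝ) - A.card * θ / p) ^ 2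
      ≤ (p : ℝ) ^ 2 * (A.card * θ / p) := by
  have hp : (p : ℝ) ≠ 0 := by exact_mod_cast (Fact.out : p.Prime).ne_zero
  have h1 : (∑ ω : ZMod p × ZMod p, (countBelow A θ ω : ℝ)) = A.card * (p * θ) := by
    exact_mod_cast sum_countBelow A hθ
  have h2 : (∑ ω : ZMod p × ZMod p, (countBelow A θ ω : ℝ) ^ 2)
      ≤ A.card * (p * θ) + A.card ^ 2 * θ ^ 2 := by
    exact_mod_cast sum_countBelow_sq_le hn A hθ
  simp only [sub_sq, Finset.sum_add_distrib, Finset.sum_sub_distrib, ← Finset.sum_mul,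
    ← Finset.mul_sum, h1, Finset.sum_const, Finset.card_univ, Fintype.card_prod, ZMod.card,
    nsmul_eq_mul, Nat.cast_mul]
  have e1 : 2 * ((A.card : ℝ) * (p * θ)) * (A.card * θ / p) = 2 * (A.card ^ 2 * θ ^ 2) := by
    field_simp
  have e2 : (p : ℝ) * p * (A.card * θ / p) ^ 2 = A.card ^ 2 * θ ^ 2 := by field_simp
  have e3 : (p : ℝ) ^ 2 * (A.card * θ / p) = A.card * (p * θ) := by field_simp
  rw [e1, e2, e3]
  linarith

/-- Chebyshev's inequality for the number of elements with small hash value. -/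
theorem card_deviation_le (hn : n ≤ p) (A : Finset (Fin n)) {θ : ℕ} (hθ : θ ≤ p) {c v : ℝ}
    (hc : 0 < c) (hv : (A.card : ℝ) * θ / p ≤ v) :
    ((Finset.univ.filter fun ω : ZMod p × ZMod p =>
      c ≤ |(countBelow A θ ω : ℝ) - A.card * θ / p|).card : ℝ) ≤ p ^ 2 * (v / c ^ 2) := by
  have h1 : ((Finset.univ.filter fun ω : ZMod p × ZMod p =>
      c ≤ |(countBelow A θ ω : ℝ) - A.card * θ / p|).card : ℝ) * c ^ 2
        ≤ ∑ ω : ZMod p × ZMod p, ((countBelow A θ ω : ℝ) - A.card * θ / p) ^ 2 := by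
    rw [← nsmul_eq_mul]
    refine (Finset.card_nsmul_le_sum _ _ _ fun ω hω => ?_).trans
      (Finset.sum_le_sum_of_subset_of_nonneg (Finset.filter_subset _ _)
        fun _ _ _ => sq_nonneg _)
    rw [← sq_abs (_ - _)]
    exact pow_le_pow_left₀ hc.le (Finset.mem_filter.1 hω).2 2
  rw [← mul_div_assoc, le_div_iff₀ (by positivity)]
  refine (h1.trans (sum_sq_countBelow_sub_le hn A hθ)).trans ?_
  exact mul_le_mul_of_nonneg_left hv (by positivity)

/-- The estimate from the sketch of `A` is off by more than a factor `1 ± η`. -/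
def Inaccurate (s : ℕ) (η : ℝ) (A : Finset (Fin n)) (ω : ZMod p × ZMod p) : Prop :=
  ¬ |sizeEstimate (sketchOf (affineHash ω) s p A) - A.card| ≤ η * A.card

/-- At threshold `p` the sketch is the whole set and the estimate is exact. -/
theorem Inaccurate.lt_card {s : ℕ} {η : ℝ} (hη : 0 ≤ η) {A : Finset (Fin n)}
    {ω : ZMod p × ZMod p} (h : Inaccurate s η A ω) :
    threshold (affineHash ω) s p A < p ∧ s < A.card := by
  have hle := threshold_le (affineHash ω) s p A
  rcases hle.lt_or_eq with hlt | heq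
  · refine ⟨hlt, (lt_card_filter hlt le_rfl).trans_le (Finset.card_filter_le _ _)⟩
  · exfalso
    apply h
    have hfil : (sketchOf (affineHash ω) s p A).2.1 = A := by
      ext x
      rw [mem_sketchOf, sketchOf_fst, heq]
      exact and_iff_left (affineHash_lt ω x)
    rw [sizeEstimate, sketchOf_fst, heq, if_pos rfl, hfil, sub_self, abs_zero]
    positivity

/-- An inaccurate estimate makes the number of elements below one of two fixed thresholds
deviate from its mean. -/
theorem Inaccurate.deviation {s : ℕ} {η : ℝ} (hs : 0 < s) (hη0 : 0 < η)
    (hη : η ≤ 1 / 6) {A : Finset (Fin n)} {ω : ZMod p × ZMod p} (h : Inaccurate s η A ω) (hn : n ≤ p)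
    {θ₁ θ₂ : ℕ} (h₁ : θ₁ = ⌈(s : ℝ) * p / ((1 + η) * A.card)⌉₊)
    (h₂ : θ₂ = ⌈(s : ℝ) * p / ((1 - η) * A.card)⌉₊) :
    s * η / 2 ≤ |(countBelow A θ₁ ω : ℝ) - A.card * θ₁ / p| ∨
      θ₂ ≤ p ∧ s * η / 2 ≤ |(countBelow A θ₂ ω : ℝ) - A.card * θ₂ / p| := by
  obtain ⟨hlt, hsA⟩ := h.lt_card hη0.le
  set τ := threshold (affineHash ω) s p A with hτ
  have hp : (0 : ℝ) < p := by exact_mod_cast (Fact.out : p.Prime).pos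
  have hA : (0 : ℝ) < A.card := by exact_mod_cast (Nat.zero_le s).trans_lt hsA
  have hsA' : (s : ℝ) < A.card := by exact_mod_cast hsA
  have hs0 : (0 : ℝ) < s := by exact_mod_cast hs
  have hAp : (A.card : ℝ) ≤ p := by
    have h1 := Finset.card_le_univ A
    rw [Fintype.card_fin] at h1
    exact_mod_cast h1.trans hn
  have hsη : 0 ≤ s * η := by positivity
  unfold Inaccurate at h
  rw [sizeEstimate, sketchOf_fst, ← hτ, if_neg hlt.ne, abs_le, not_and_or] at h
  have hcase : θ₂ ≤ τ ∨ τ < θ₁ := by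
    -- Threshold `0` is separated out: its estimate is the default `0`, an underestimate, but the
    -- threshold itself is too low.
    rcases Nat.eq_zero_or_pos τ with h0 | h0
    · right
      rw [h0, h₁]
      exact Nat.ceil_pos.2 (by positivity)
    have h0' : (0 : ℝ) < τ := by exact_mod_cast h0
    rcases h with h | h
    · left
      have hest : (s : ℝ) * p / τ < (1 - η) * A.card := by linarith
      rw [h₂]
      refine Nat.ceil_le.2 ?_
      rw [div_lt_iff₀ h0'] at hest
      rw [div_le_iff₀ (by nlinarith)]
      linarith
    · right
      have hest : (1 + η) * A.card < (s : ℝ) * p / τ := by linarith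
      rw [h₁]
      refine Nat.lt_ceil.2 ?_
      rw [lt_div_iff₀ h0'] at hest
      rw [lt_div_iff₀ (by positivity)]
      linarith
  rcases hcase with hle | hlt₁
  · right
    refine ⟨hle.trans hlt.le, ?_⟩
    -- At most `s` elements lie below `θ₂ ≤ τ`, although about `s/(1-η) ≥ s(1+η)` are expected.
    have hcount : countBelow A θ₂ ω ≤ s := by
      refine (Finset.card_le_card ?_).trans (card_filter_threshold_le (affineHash ω) s p A)
      intro x hx
      rw [Finset.mem_filter] at hx ⊢
      exact ⟨hx.1, hx.2.trans_le hle⟩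
    have hcount' : (countBelow A θ₂ ω : ℝ) ≤ s := by exact_mod_cast hcount
    have hmean : s + s * η ≤ (A.card : ℝ) * θ₂ / p := by
      have h1 : (s : ℝ) * p / ((1 - η) * A.card) ≤ θ₂ := by rw [h₂]; exact Nat.le_ceil _
      rw [div_le_iff₀ (by nlinarith)] at h1
      rw [le_div_iff₀ hp]
      have h2 : (s + s * η) * p ≤ (1 + η) * (θ₂ * ((1 - η) * A.card)) := by nlinarith
      have h3 : (0 : ℝ) ≤ θ₂ * A.card := by positivity
      nlinarith [mul_nonneg h3 (sq_nonneg η)]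
    rw [abs_sub_comm]
    exact le_trans (by linarith) (le_abs_self _)
  · left
    have hθp : θ₁ ≤ p := by
      rw [h₁]
      refine Nat.ceil_le.2 ?_
      rw [div_le_iff₀ (by positivity)]
      nlinarith [mul_le_mul_of_nonneg_left hsA'.le hp.le, mul_pos (mul_pos hp hη0) hA]
    -- Maximality of `τ` gives more than `s` elements below `θ₁`. The extra `1` offsets the loss
    -- from rounding `θ₁` up.
    have hcount : s + 1 ≤ countBelow A θ₁ ω := lt_card_filter hlt₁ hθp
    have hcount' : (s : ℝ) + 1 ≤ countBelow A θ₁ ω := by exact_mod_cast hcount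
    have hmean : (A.card : ℝ) * θ₁ / p ≤ s / (1 + η) + 1 := by
      have h1 : (θ₁ : ℝ) ≤ (s : ℝ) * p / ((1 + η) * A.card) + 1 := by
        rw [h₁]; exact (Nat.ceil_lt_add_one (by positivity)).le
      rw [div_le_iff₀ hp]
      calc (A.card : ℝ) * θ₁ ≤ A.card * ((s : ℝ) * p / ((1 + η) * A.card) + 1) :=
            mul_le_mul_of_nonneg_left h1 hA.le
        _ = s / (1 + η) * p + A.card := by field_simp
        _ ≤ _ := by linarith
    have hdiv : (s : ℝ) / (1 + η) ≤ s - s * η / 2 := by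
      rw [div_le_iff₀ (by positivity)]
      nlinarith
    exact le_trans (by linarith) (le_abs_self _)

theorem card_inaccurate_le (hn : n ≤ p) {s : ℕ} {η : ℝ} (hη0 : 0 < η) (hη : η ≤ 1 / 6)
    (hs : 400 / η ^ 2 ≤ s) (A : Finset (Fin n)) :
    ((Finset.univ.filter fun ω : ZMod p × ZMod p => Inaccurate s η A ω).card : ℝ)
      ≤ p ^ 2 / 16 := by
  have hp : (0 : ℝ) < p := by exact_mod_cast (Fact.out : p.Prime).pos
  have hs0 : (0 : ℝ) < s := lt_of_lt_of_le (by positivity) hs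
  have hs1 : (1 : ℝ) ≤ s := by
    have : 0 < s := by exact_mod_cast hs0
    exact_mod_cast this
  rcases le_or_gt A.card s with hAs | hAs
  · rw [Finset.filter_false_of_mem fun ω _ h => absurd (h.lt_card hη0.le).2 (not_lt.2 hAs)]
    simp only [Finset.card_empty, Nat.cast_zero]
    positivity
  have hA : (0 : ℝ) < A.card := by exact_mod_cast (Nat.zero_le s).trans_lt hAs
  have hAs' : (s : ℝ) < A.card := by exact_mod_cast hAs
  have hAp : (A.card : ℝ) ≤ p := by
    have h1 := Finset.card_le_univ A
    rw [Fintype.card_fin] at h1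
    exact_mod_cast h1.trans hn
  -- Both `1 + η` and `1 - η` are at least `5/6`, so `s/e ≤ 2s`; rounding adds at most `1 ≤ s`.
  have hmean : ∀ e : ℝ, 5 / 6 ≤ e →
      (A.card : ℝ) * ⌈(s : ℝ) * p / (e * A.card)⌉₊ / p ≤ 3 * s := by
    intro e he
    have he0 : 0 < e := by linarith
    have h1 : (⌈(s : ℝ) * p / (e * A.card)⌉₊ : ℝ) ≤ (s : ℝ) * p / (e * A.card) + 1 :=
      (Nat.ceil_lt_add_one (by positivity)).le
    rw [div_le_iff₀ hp]
    calc (A.card : ℝ) * ⌈(s : ℝ) * p / (e * A.card)⌉₊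
          ≤ A.card * ((s : ℝ) * p / (e * A.card) + 1) := mul_le_mul_of_nonneg_left h1 hA.le
      _ = s / e * p + A.card := by field_simp
      _ ≤ 2 * s * p + s * p := by
          have : (s : ℝ) / e ≤ 2 * s := by rw [div_le_iff₀ he0]; nlinarith
          have := mul_le_mul_of_nonneg_right this hp.le
          nlinarith
      _ = _ := by ring
  set θ₁ := ⌈(s : ℝ) * p / ((1 + η) * A.card)⌉₊ with hθ₁
  set θ₂ := ⌈(s : ℝ) * p / ((1 - η) * A.card)⌉₊ with hθ₂
  have hθ₁p : θ₁ ≤ p := by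
    rw [hθ₁]
    refine Nat.ceil_le.2 ?_
    rw [div_le_iff₀ (by positivity)]
    nlinarith [mul_le_mul_of_nonneg_left hAs'.le hp.le, mul_pos (mul_pos hp hη0) hA]
  have hc : 0 < s * η / 2 := by positivity
  -- Chebyshev gives `12/(sη²) ≤ 12/400 < 1/32` for each of the two thresholds.
  have hsmall : (p : ℝ) ^ 2 * (3 * s / (s * η / 2) ^ 2) ≤ p ^ 2 / 32 := by
    rw [div_le_iff₀ (by positivity)] at hs
    have : (3 : ℝ) * s / (s * η / 2) ^ 2 ≤ 1 / 32 := by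
      rw [div_le_div_iff₀ (by positivity) (by norm_num)]
      nlinarith
    have := mul_le_mul_of_nonneg_left this (sq_nonneg (p : ℝ))
    linarith
  have b₁ := (card_deviation_le hn A hθ₁p hc (hmean (1 + η) (by linarith))).trans hsmall
  have b₂ : ((Finset.univ.filter fun ω : ZMod p × ZMod p =>
      θ₂ ≤ p ∧ s * η / 2 ≤ |(countBelow A θ₂ ω : ℝ) - A.card * θ₂ / p|).card : ℝ)
        ≤ p ^ 2 / 32 := by
    by_cases hθ₂p : θ₂ ≤ p
    · simp only [hθ₂p, true_and]
      exact (card_deviation_le hn A hθ₂p hc (hmean (1 - η) (by linarith))).trans hsmall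
    · simp only [hθ₂p, false_and, Finset.filter_false, Finset.card_empty, Nat.cast_zero]
      positivity
  have hsub : (Finset.univ.filter fun ω : ZMod p × ZMod p => Inaccurate s η A ω) ⊆
      (Finset.univ.filter fun ω : ZMod p × ZMod p =>
        s * η / 2 ≤ |(countBelow A θ₁ ω : ℝ) - A.card * θ₁ / p|) ∪
      Finset.univ.filter fun ω : ZMod p × ZMod p =>
        θ₂ ≤ p ∧ s * η / 2 ≤ |(countBelow A θ₂ ω : ℝ) - A.card * θ₂ / p| := by
    intro ω hω
    rw [← Finset.filter_or, Finset.mem_filter]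
    exact ⟨Finset.mem_univ _,
      (Finset.mem_filter.1 hω).2.deviation (by exact_mod_cast hs0) hη0 hη hn hθ₁ hθ₂⟩
  have h1 := (Finset.card_le_card hsub).trans (Finset.card_union_le _ _)
  have h2 : ((Finset.univ.filter fun ω : ZMod p × ZMod p => Inaccurate s η A ω).card : ℝ) ≤ _ :=
    Nat.cast_le.2 h1
  rw [Nat.cast_add] at h2
  linarith

end Affine

/-! ### Medians -/

/-- Take the smallest value `v i` such that at least half of the entries are at most `v i`; the next
smaller value fails this. -/
theorem exists_median {t : ℕ} (v : Fin t → ℝ) :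
    ∃ y : ℝ, 2 * (Finset.univ.filter fun j => v j < y).card ≤ t ∧
      2 * (Finset.univ.filter fun j => y < v j).card ≤ t := by
  rcases Nat.eq_zero_or_pos t with rfl | ht
  · exact ⟨0, by simp⟩
  set T := Finset.univ.filter fun i => t ≤ 2 * (Finset.univ.filter fun j => v j ≤ v i).card
    with hT
  have hne : T.Nonempty := by
    obtain ⟨i, -, hi⟩ := Finset.exists_max_image (Finset.univ : Finset (Fin t)) v
      ⟨⟨0, ht⟩, Finset.mem_univ _⟩
    refine ⟨i, Finset.mem_filter.2 ⟨Finset.mem_univ _, ?_⟩⟩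
    rw [Finset.filter_true_of_mem hi, Finset.card_univ, Fintype.card_fin]
    omega
  obtain ⟨i, hiT, hi⟩ := Finset.exists_min_image T v hne
  have hiT' := (Finset.mem_filter.1 hiT).2
  refine ⟨v i, ?_, ?_⟩
  · rcases (Finset.univ.filter fun j => v j < v i).eq_empty_or_nonempty with h0 | hD
    · simp [h0]
    obtain ⟨j, hjD, hj⟩ := Finset.exists_max_image _ v hD
    have hjT : j ∉ T := fun hjT =>
      absurd (hi j hjT) (not_le.2 (Finset.mem_filter.1 hjD).2)
    have hlt : 2 * (Finset.univ.filter fun l => v l ≤ v j).card < t := by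
      by_contra hcon
      exact hjT (Finset.mem_filter.2 ⟨Finset.mem_univ _, not_lt.1 hcon⟩)
    have hsub : (Finset.univ.filter fun j => v j < v i) ⊆
        Finset.univ.filter fun l => v l ≤ v j := fun l hl =>
      Finset.mem_filter.2 ⟨Finset.mem_univ _, hj l hl⟩
    have := Finset.card_le_card hsub
    omega
  · have h := Finset.card_filter_add_card_filter_not (s := (Finset.univ : Finset (Fin t)))
      (fun j => v j ≤ v i)
    simp only [not_le, Finset.card_univ, Fintype.card_fin] at h
    omega

/-- A median of finitely many numbers. -/
def median {t : ℕ} (v : Fin t → ℝ) : ℝ := (exists_median v).choose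

/-- If more than half of the numbers are close to `d` then so is the median. -/
theorem abs_median_sub_le {t : ℕ} (v : Fin t → ℝ) {d e : ℝ}
    (h : 2 * (Finset.univ.filter fun j => ¬ |v j - d| ≤ e).card < t) : |median v - d| ≤ e := by
  obtain ⟨hlow, hhigh⟩ := (exists_median v).choose_spec
  change 2 * (Finset.univ.filter fun j => v j < median v).card ≤ t at hlow
  change 2 * (Finset.univ.filter fun j => median v < v j).card ≤ t at hhigh
  have hsum := Finset.card_filter_add_card_filter_not (s := (Finset.univ : Finset (Fin t)))
    (fun j => |v j - d| ≤ e)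
  rw [Finset.card_univ, Fintype.card_fin] at hsum
  rw [abs_le]
  -- If the median missed the interval on one side, all the good values, more than half, would lie
  -- strictly on its other side.
  constructor <;> by_contra hcon
  · have hsub : (Finset.univ.filter fun j => |v j - d| ≤ e) ⊆
        Finset.univ.filter fun j => median v < v j := by
      intro j hj
      rw [Finset.mem_filter] at hj ⊢
      exact ⟨hj.1, by linarith [(abs_le.1 hj.2).1]⟩
    have := Finset.card_le_card hsub
    omega
  · have hsub : (Finset.univ.filter fun j => |v j - d| ≤ e) ⊆
        Finset.univ.filter fun j => v j < median v := by
      intro j hj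
      rw [Finset.mem_filter] at hj ⊢
      exact ⟨hj.1, by linarith [(abs_le.1 hj.2).2]⟩
    have := Finset.card_le_card hsub
    omega

/-- Among `t` independent samples at least half are bad with probability at most `2⁻ᵗ`, if one
sample is bad with probability at most `1/16`. -/
theorem card_half_bad_le {Ω : Type} [Fintype Ω] (B : Ω → Prop) (t : ℕ)
    (hB : ((Finset.univ.filter B).card : ℝ) ≤ Fintype.card Ω / 16) :
    ((Finset.univ.filter fun ω : Fin t → Ω =>
        t ≤ 2 * (Finset.univ.filter fun j => B (ω j)).card).card : ℝ)
      ≤ (Fintype.card Ω : ℝ) ^ t / 2 ^ t := by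
  -- Exponential moment: a bad sample has weight `16`, so one sample averages at most `1 + 15/16 ≤
  -- 2`, while half bad samples force a product of at least `4ᵗ`.
  have hsum : ∑ ω : Fin t → Ω, ∏ j, (if B (ω j) then (16 : ℝ) else 1)
      = (∑ x : Ω, if B x then (16 : ℝ) else 1) ^ t :=
    (Fintype.sum_pow (fun x : Ω => if B x then (16 : ℝ) else 1) t).symm
  have hone : (∑ x : Ω, if B x then (16 : ℝ) else 1) ≤ 2 * Fintype.card Ω := by
    have h : ∀ x : Ω, (if B x then (16 : ℝ) else 1) = 1 + 15 * if B x then 1 else 0 := by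
      intro x; split_ifs <;> norm_num
    simp only [h, Finset.sum_add_distrib, ← Finset.mul_sum, Finset.sum_boole,
      Finset.sum_const, Finset.card_univ, nsmul_eq_mul, mul_one]
    have : (0 : ℝ) ≤ Fintype.card Ω := Nat.cast_nonneg _
    linarith
  have hlow : ((Finset.univ.filter fun ω : Fin t → Ω =>
      t ≤ 2 * (Finset.univ.filter fun j => B (ω j)).card).card : ℝ) * 4 ^ t
        ≤ ∑ ω : Fin t → Ω, ∏ j, (if B (ω j) then (16 : ℝ) else 1) := by
    rw [← nsmul_eq_mul]
    refine (Finset.card_nsmul_le_sum _ _ _ fun ω hω => ?_).trans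
      (Finset.sum_le_sum_of_subset_of_nonneg (Finset.filter_subset _ _) fun ω _ _ =>
        Finset.prod_nonneg fun j _ => by split_ifs <;> norm_num)
    rw [Finset.prod_ite, Finset.prod_const, Finset.prod_const, one_pow, mul_one,
      show (16 : ℝ) = 4 ^ 2 by norm_num, ← pow_mul]
    exact pow_le_pow_right₀ (by norm_num) (Finset.mem_filter.1 hω).2
  have hnn : (0 : ℝ) ≤ ∑ x : Ω, if B x then (16 : ℝ) else 1 :=
    Finset.sum_nonneg fun x _ => by split_ifs <;> norm_num
  have h := (hlow.trans_eq hsum).trans (pow_le_pow_left₀ hnn hone t)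
  rw [mul_pow] at h
  rw [le_div_iff₀ (by positivity)]
  have h4 : (4 : ℝ) ^ t = 2 ^ t * 2 ^ t := by rw [← mul_pow]; norm_num
  rw [h4, ← mul_assoc, mul_comm ((2 : ℝ) ^ t) ((Fintype.card Ω : ℝ) ^ t)] at h
  exact le_of_mul_le_mul_right h (by positivity)

/-! ### The sketching scheme -/

variable {n : ℕ}

/-- The median of the estimates from `t` independent threshold sketches. -/
def medianScheme (n p s t : ℕ) [Fact p.Prime] : SketchScheme n where
  Seed := Fin t → ZMod p × ZMod p
  finite_seed := inferInstance
  Sk := Fin t → ThresholdSketch n s p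
  finite_sk := inferInstance
  seedDist := PMF.uniformOfFintype (Fin t → ZMod p × ZMod p)
  empty ω j := sketchOf (affineHash (ω j)) s p ∅
  add ω σ x j := addElem (affineHash (ω j)) (σ j) x
  estimate ω M :=
    median fun j => sizeEstimate (merge (affineHash (ω j)) (M.map fun σ => σ j))

section

variable {p : ℕ} [Fact p.Prime] {s t : ℕ}

theorem medianScheme_sketch (ω : Fin t → ZMod p × ZMod p) (l : List (Fin n)) (j : Fin t) :
    (medianScheme n p s t).sketch ω l j = sketchOf (affineHash (ω j)) s p l.toFinset := by
  have h : ∀ (l : List (Fin n)) (σ : Fin t → ThresholdSketch n s p),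
      l.foldl ((medianScheme n p s t).add ω) σ j
        = l.foldl (addElem (affineHash (ω j))) (σ j) := by
    intro l
    induction l with
    | nil => intro σ; rfl
    | cons x l ih => intro σ; exact ih _
  refine (h l _).trans ?_
  refine (foldl_addElem _ s p l ∅).trans ?_
  rw [Finset.empty_union]

theorem medianScheme_estimate (ω : Fin t → ZMod p × ZMod p) (C : Multiset (List (Fin n))) :
    (medianScheme n p s t).estimate ω (C.map ((medianScheme n p s t).sketch ω))
      = median fun j => sizeEstimate (sketchOf (affineHash (ω j)) s p (unionOf C)) := by
  change median _ = _
  congr 1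
  funext j
  have h : (C.map ((medianScheme n p s t).sketch ω)).map
        (fun σ : Fin t → ThresholdSketch n s p => σ j)
      = C.map fun l => sketchOf (affineHash (ω j)) s p l.toFinset :=
    (Multiset.map_map _ _ _).trans
      (Multiset.map_congr rfl fun l _ => medianScheme_sketch ω l j)
  exact congrArg sizeEstimate ((congrArg (merge _) h).trans (merge_sketchOf _ s p C))

theorem medianScheme_isF0Sketch (hn : n ≤ p) {η δ : ℝ} (hη0 : 0 < η) (hη : η ≤ 1 / 6)
    (hs : 400 / η ^ 2 ≤ s) (hδ : 1 / 2 ^ t ≤ δ) : (medianScheme n p s t).IsF0Sketch η δ := by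
  intro C
  have hp : (0 : ℝ) < p := by exact_mod_cast (Fact.out : p.Prime).pos
  have hcard : (Fintype.card (ZMod p × ZMod p) : ℝ) = p ^ 2 := by
    rw [Fintype.card_prod, ZMod.card, Nat.cast_mul, sq]
  refine le_trans ?_ hδ
  refine (prob_uniform (α := Fin t → ZMod p × ZMod p) _).trans_le ?_
  have hbad := card_half_bad_le (fun ω : ZMod p × ZMod p => Inaccurate s η (unionOf C) ω) t
    (by rw [hcard]; exact card_inaccurate_le hn hη0 hη hs _)
  rw [Fintype.card_fun, Fintype.card_fin, Nat.cast_pow, hcard]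
  rw [hcard] at hbad
  rw [div_le_iff₀ (by positivity), one_div, inv_mul_eq_div]
  refine le_trans (Nat.cast_le.2 (Finset.card_le_card fun ω hω => ?_)) hbad
  rw [Finset.mem_filter] at hω ⊢
  refine ⟨hω.1, ?_⟩
  by_contra hcon
  refine hω.2 ?_
  change |(medianScheme n p s t).estimate ω (C.map ((medianScheme n p s t).sketch ω))
    - (unionOf C).card| ≤ η * (unionOf C).card
  rw [medianScheme_estimate]
  refine abs_median_sub_le _ ?_
  convert Nat.lt_of_not_le hcon

/-! ### Space -/

/-- Every such set is the range of a `K`-tuple of optional elements. -/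
theorem natCard_card_le_le {α : Type} [Finite α] (K : ℕ) :
    Nat.card {T : Finset α // T.card ≤ K} ≤ (Nat.card α + 1) ^ K := by
  have : Fintype α := Fintype.ofFinite α
  let f : (Fin K → Option α) → {T : Finset α // T.card ≤ K} := fun g =>
    ⟨(Finset.univ.image g).eraseNone, by
      refine (Finset.card_le_card_of_injOn some (fun a ha => ?_)
        (Option.some_injective α).injOn).trans
        (Finset.card_image_le (s := Finset.univ) (f := g)) |>.trans (by simp)
      simpa using ha⟩
  have hf : Function.Surjective f := by
    rintro ⟨T, hT⟩
    obtain ⟨e⟩ : Nonempty (T ↪ Fin K) :=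
      Function.Embedding.nonempty_of_card_le (by simpa using hT)
    refine ⟨fun i => if h : ∃ x : T, e x = i then some h.choose.1 else none, ?_⟩
    refine Subtype.ext ?_
    ext a
    simp only [f, Finset.mem_eraseNone, Finset.mem_image, Finset.mem_univ, true_and]
    constructor
    · rintro ⟨i, hi⟩
      split_ifs at hi with h
      rw [Option.some.injEq] at hi
      exact hi ▸ h.choose.2
    · intro ha
      have h : ∃ x : T, e x = e ⟨a, ha⟩ := ⟨_, rfl⟩
      refine ⟨e ⟨a, ha⟩, ?_⟩
      rw [dif_pos h, e.injective h.choose_spec]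
  refine (Nat.card_le_card_of_surjective f hf).trans_eq ?_
  rw [Nat.card_eq_fintype_card, Fintype.card_fun, Fintype.card_option, Fintype.card_fin,
    Nat.card_eq_fintype_card]

theorem natCard_medianScheme_seed :
    Nat.card (medianScheme n p s t).Seed = (p * p) ^ t := by
  change Nat.card (Fin t → ZMod p × ZMod p) = _
  rw [Nat.card_eq_fintype_card, Fintype.card_fun, Fintype.card_prod, ZMod.card, Fintype.card_fin]

theorem natCard_medianScheme_sk_le :
    Nat.card (medianScheme n p s t).Sk ≤ ((p + 1) * (n + 1) ^ s) ^ t := by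
  change Nat.card (Fin t → ThresholdSketch n s p) ≤ _
  rw [Nat.card_fun, Nat.card_fin, Nat.card_prod, Nat.card_fin]
  refine Nat.pow_le_pow_left (Nat.mul_le_mul_left _ ?_) _
  exact (natCard_card_le_le s).trans_eq (by rw [Nat.card_fin])

/-- Indices, sizes and elements take `b` bits each, thresholds and hash coefficients `2b`. The
constant is `14 = 4 + 5 + 5`, for the seed, the current set and the store. -/
theorem space_largestSets_le {m K k b : ℕ} (hK : 0 < K) (hs : 0 < s) (ht : 0 < t)
    (hb : n + m + 2 ≤ 2 ^ b) (hp : p + 1 ≤ 2 ^ (2 * b)) :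
    (largestSets n m K k (medianScheme n p s t)).space ≤ 14 * b * K * t * s := by
  have hfs := (medianScheme n p s t).finite_sk
  have hSk : Nat.card (medianScheme n p s t).Sk ≤ 2 ^ (t * (s + 2) * b) := by
    refine natCard_medianScheme_sk_le.trans ?_
    calc ((p + 1) * (n + 1) ^ s) ^ t ≤ (2 ^ (2 * b) * (2 ^ b) ^ s) ^ t :=
          Nat.pow_le_pow_left (Nat.mul_le_mul hp (Nat.pow_le_pow_left (by omega) _)) _
      _ = 2 ^ (t * (s + 2) * b) := by
          rw [← pow_mul, ← pow_add, ← pow_mul]; congr 1; ring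
  have hne : 0 < Nat.card (medianScheme n p s t).Sk := by
    have : Nonempty (medianScheme n p s t).Sk :=
      ⟨(medianScheme n p s t).empty fun _ => (0, 0)⟩
    exact Nat.card_pos
  have hseed : Nat.card (medianScheme n p s t).Seed ≤ 2 ^ (4 * t * b) := by
    rw [natCard_medianScheme_seed]
    calc (p * p) ^ t ≤ (2 ^ (2 * b) * 2 ^ (2 * b)) ^ t :=
          Nat.pow_le_pow_left (Nat.mul_le_mul (by omega) (by omega)) _
      _ = 2 ^ (4 * t * b) := by rw [← pow_add, ← pow_mul]; congr 1; ring
  have hcount : (m + 1) * (n + 1) ≤ 2 ^ (2 * b) := by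
    calc (m + 1) * (n + 1) ≤ 2 ^ b * 2 ^ b := Nat.mul_le_mul (by omega) (by omega)
      _ = 2 ^ (2 * b) := by rw [← pow_add]; congr 1; ring
  have hcs : (m + 1) * ((n + 1) * Nat.card (medianScheme n p s t).Sk)
      ≤ 2 ^ ((2 + t * (s + 2)) * b) := by
    rw [← mul_assoc]
    refine (Nat.mul_le_mul hcount hSk).trans_eq ?_
    rw [← pow_add]; congr 1; ring
  have hstore : Nat.card (Store n m K (medianScheme n p s t).Sk)
      ≤ 2 ^ ((2 + t * (s + 2)) * b * K) := by
    refine (natCard_card_le_le K).trans ?_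
    rw [Nat.card_prod, Nat.card_prod, Nat.card_fin, Nat.card_fin, pow_mul]
    refine Nat.pow_le_pow_left (le_trans ?_ hcs) _
    -- The extra option in the count of small sets is absorbed by passing from `m` to `m + 1`.
    rw [add_mul m 1, one_mul]
    refine Nat.add_le_add_left ?_ _
    exact Nat.mul_pos (Nat.succ_pos n) hne
  refine Nat.clog_le_of_le_pow ?_
  change Nat.card (Memory n m K (medianScheme n p s t)) ≤ _
  rw [Nat.card_prod, Nat.card_prod, Nat.card_prod, Nat.card_prod, Nat.card_fin, Nat.card_fin]
  refine (Nat.mul_le_mul hseed (Nat.mul_le_mul hcs hstore)).trans ?_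
  rw [← pow_add, ← pow_add]
  refine Nat.pow_le_pow_right (by norm_num) ?_
  have e1 : 4 * t ≤ 4 * (K * (t * s)) := by
    refine Nat.mul_le_mul_left _ ?_
    exact (Nat.le_mul_of_pos_right t hs).trans (Nat.le_mul_of_pos_left _ hK)
  have e2 : 2 + t * (s + 2) ≤ 5 * (t * s) := by
    have h1 : t ≤ t * s := Nat.le_mul_of_pos_right t hs
    rw [mul_add]
    omega
  have e3 : 2 + t * (s + 2) ≤ 5 * (K * (t * s)) :=
    e2.trans (Nat.mul_le_mul_left _ (Nat.le_mul_of_pos_left _ hK))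
  have f1 := Nat.mul_le_mul_right b e1
  have f2 := Nat.mul_le_mul_right b e3
  have f3 := Nat.mul_le_mul_right K (Nat.mul_le_mul_right b e2)
  calc _ ≤ 4 * (K * (t * s)) * b + (5 * (K * (t * s)) * b + 5 * (t * s) * b * K) :=
        Nat.add_le_add f1 (Nat.add_le_add f2 f3)
    _ = _ := by ring

end

/-- For `N ≥ 3` the logarithm is at least `1` and absorbs the rounding. -/
theorem clog_le_three_mul_log {N : ℕ} (hN : 3 ≤ N) : (Nat.clog 2 N : ℝ) ≤ 3 * Real.log N := by
  have hlog : 1 ≤ Real.log N := by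
    rw [Real.le_log_iff_exp_le (by positivity)]
    have h3 : (3 : ℝ) ≤ N := by exact_mod_cast hN
    linarith [Real.exp_one_lt_d9]
  have h1 : 2 ^ (Nat.clog 2 N - 1) < N := Nat.pow_pred_clog_lt_self (by norm_num) (by omega)
  have h2 : ((2 : ℝ) ^ (Nat.clog 2 N - 1)) ≤ N := by exact_mod_cast h1.le
  have h3 := Real.log_le_log (by positivity) h2
  rw [Real.log_pow] at h3
  have h4 : (Nat.clog 2 N : ℝ) ≤ (Nat.clog 2 N - 1 : ℕ) + 1 := by
    exact_mod_cast (by omega : Nat.clog 2 N ≤ Nat.clog 2 N - 1 + 1)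
  have h5 : (0 : ℝ) ≤ ((Nat.clog 2 N - 1 : ℕ) : ℝ) := Nat.cast_nonneg _
  nlinarith [Real.log_two_gt_d9]

/-- The space bound as a real expression in the parameters of the problem. -/
theorem space_bound_le {a b K s k r : ℕ} {ε L : ℝ} (hk : 1 ≤ k) (hr : 1 ≤ r) (hε0 : 0 < ε)
    (hε : ε ≤ 1) (hK : K = ⌈(r : ℝ) * k / (ε / 6)⌉₊) (hs : s = ⌈400 / (ε / 6) ^ 2⌉₊)
    (hb : (b : ℝ) ≤ 3 * L) :
    ((14 * b * K * ((a + k) * b) * s : ℕ) : ℝ)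
      ≤ 126 * 7 * 14401 * (a + 1) * ((k : ℝ) ^ 2 * r / ε ^ 3) * L ^ 2 := by
  have hk' : (1 : ℝ) ≤ k := by exact_mod_cast hk
  have hr' : (1 : ℝ) ≤ r := by exact_mod_cast hr
  have hrk : 1 ≤ (r : ℝ) * k := one_le_mul_of_one_le_of_one_le hr' hk'
  have hK' : (K : ℝ) ≤ 7 * (r * k) / ε := by
    have h1 : (K : ℝ) ≤ (r : ℝ) * k / (ε / 6) + 1 := by
      rw [hK]; exact (Nat.ceil_lt_add_one (by positivity)).le
    have h2 : (1 : ℝ) ≤ r * k / ε := by rw [le_div_iff₀ hε0]; linarith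
    have h3 : (r : ℝ) * k / (ε / 6) = 6 * (r * k / ε) := by field_simp
    rw [mul_div_assoc]; linarith
  have hs' : (s : ℝ) ≤ 14401 / ε ^ 2 := by
    have h1 : (s : ℝ) ≤ 400 / (ε / 6) ^ 2 + 1 := by
      rw [hs]; exact (Nat.ceil_lt_add_one (by positivity)).le
    have h2 : (1 : ℝ) ≤ 1 / ε ^ 2 := by
      rw [le_div_iff₀ (by positivity), one_mul]; exact pow_le_one₀ hε0.le hε
    have h3 : (400 : ℝ) / (ε / 6) ^ 2 = 14400 * (1 / ε ^ 2) := by field_simp; norm_num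
    have h4 : (14401 : ℝ) / ε ^ 2 = 14401 * (1 / ε ^ 2) := by ring
    linarith
  -- The second factor `k` of the space bound enters here, from the number of copies.
  have hak : (a : ℝ) + k ≤ (a + 1) * k := by
    have : (0 : ℝ) ≤ a := Nat.cast_nonneg a
    nlinarith
  have hb2 : (b : ℝ) ^ 2 ≤ (3 * L) ^ 2 := pow_le_pow_left₀ (Nat.cast_nonneg b) hb 2
  push_cast
  calc (14 * b * K * ((a + k) * b) * s : ℝ) = 14 * (b ^ 2 * (K * ((a + k) * s))) := by ring
    _ ≤ 14 * ((3 * L) ^ 2 * (7 * (r * k) / ε * ((a + 1) * k * (14401 / ε ^ 2)))) := by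
        gcongr
    _ = _ := by field_simp; ring

end StreamCoverage

end

/-! ### Choice of parameters -/

open StreamCoverage in
theorem mainTheorem2 (a : ℕ) :
    ∃ (C : ℝ) (c : ℕ), ∀ (n m k r : ℕ) (ε : ℝ),
      1 ≤ k → k ≤ m → 1 ≤ r → 0 < ε → ε ≤ 1 →
      ∃ A : StreamAlgorithm (Token n) (Finset (Fin m)),
        -- the algorithm keeps `F₀` sketches of the `⌈rk/η⌉` largest sets, where `η = ε/6`,
        -- and returns `k` of these sets with the largest estimated coverage
        (∃ Φ : SketchScheme n,
          Φ.IsF0Sketch (ε / 6) (1 / (((n : ℝ) + m) ^ a * (m.choose k : ℝ))) ∧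
          A = largestSets n m ⌈(r : ℝ) * k / (ε / 6)⌉₊ k Φ) ∧
        -- space, in bits
        (A.space : ℝ) ≤ C * ((k : ℝ) ^ 2 * r / ε ^ 3) * Real.log ((n : ℝ) + m + 2) ^ c ∧
        -- failure probability on every stream of `m` sets with multiplicity at most `r`
        ∀ S : SetStream n m, (∀ x, S.multiplicity x ≤ r) →
          prob (A.run S.tokens) {I | ¬ S.IsApprox k (1 + ε) I} ≤ 1 / (m : ℝ) ^ a := by
  refine ⟨126 * 7 * 14401 * (a + 1), 2, fun n m k r ε hk hkm hr hε0 hε => ?_⟩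
  -- Bertrand's postulate: `p` must exceed `n` for pairwise independence and stay linear in `n` for
  -- the space.
  obtain ⟨p, hp, hnp, hp2⟩ := Nat.exists_prime_lt_and_le_two_mul (n + 1) (Nat.succ_ne_zero n)
  have : Fact p.Prime := ⟨hp⟩
  set b := Nat.clog 2 (n + m + 2) with hb
  have hb2 : n + m + 2 ≤ 2 ^ b := Nat.le_pow_clog (by norm_num) _
  have hb0 : 0 < b := Nat.clog_pos (by norm_num) (by omega)
  set K := ⌈(r : ℝ) * k / (ε / 6)⌉₊ with hK
  set s := ⌈400 / (ε / 6) ^ 2⌉₊ with hs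
  have hk' : (1 : ℝ) ≤ k := by exact_mod_cast hk
  have hr' : (1 : ℝ) ≤ r := by exact_mod_cast hr
  have hK0 : 0 < K := Nat.ceil_pos.2 (by positivity)
  have hs0 : 0 < s := Nat.ceil_pos.2 (by positivity)
  have hrk : (r : ℝ) * k ≤ ε / 6 * K := by
    have := Nat.le_ceil ((r : ℝ) * k / (ε / 6))
    rw [← hK, div_le_iff₀ (by positivity)] at this
    linarith
  have hkK : k ≤ K := by
    have : (k : ℝ) ≤ K := by
      have hK' : (0 : ℝ) ≤ K := Nat.cast_nonneg _
      nlinarith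
    exact_mod_cast this
  have hchoose : 0 < m.choose k := Nat.choose_pos hkm
  -- With `n + m + 2 ≤ 2 ^ b`, `ab` copies pay for `(n + m) ^ a` and `kb` for `m.choose k ≤ m ^ k`.
  have hδ : (1 : ℝ) / 2 ^ ((a + k) * b) ≤ 1 / (((n : ℝ) + m) ^ a * (m.choose k : ℝ)) := by
    have h1 : (n + m) ^ a * m.choose k ≤ 2 ^ ((a + k) * b) := by
      calc (n + m) ^ a * m.choose k ≤ (2 ^ b) ^ a * (2 ^ b) ^ k :=
            Nat.mul_le_mul (Nat.pow_le_pow_left (by omega) _)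
              ((Nat.choose_le_pow m k).trans (Nat.pow_le_pow_left (by omega) _))
        _ = _ := by rw [← pow_mul, ← pow_mul, ← pow_add]; congr 1; ring
    have h2 : ((n : ℝ) + m) ^ a * (m.choose k : ℝ) ≤ 2 ^ ((a + k) * b) := by exact_mod_cast h1
    refine one_div_le_one_div_of_le ?_ h2
    have : 0 < (n + m) ^ a * m.choose k :=
      Nat.mul_pos (Nat.pow_pos (by omega)) hchoose
    exact_mod_cast this
  have hF0 : (medianScheme n p s ((a + k) * b)).IsF0Sketch (ε / 6)
      (1 / (((n : ℝ) + m) ^ a * (m.choose k : ℝ))) :=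
    medianScheme_isF0Sketch (by omega) (by positivity) (by linarith) (Nat.le_ceil _) hδ
  refine ⟨_, ⟨_, hF0, rfl⟩, ?_, fun S hS => ?_⟩
  · have hp3 : p + 1 ≤ 2 ^ (2 * b) := by
      have h1 : (n + m + 2) * (n + m + 2) ≤ 2 ^ (2 * b) := by
        rw [two_mul, pow_add]; exact Nat.mul_le_mul hb2 hb2
      nlinarith
    refine (Nat.cast_le.2 (space_largestSets_le hK0 hs0
      (Nat.mul_pos (by omega) hb0) hb2 hp3)).trans ?_
    refine space_bound_le hk hr hε0 hε hK hs ?_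
    have := clog_le_three_mul_log (N := n + m + 2) (by omega)
    exact_mod_cast this
  · have h := prob_not_isApprox_le S (by positivity) (by linarith) hS hkm hkK hK0 hrk hF0
    rw [show 1 + 6 * (ε / 6) = 1 + ε by ring] at h
    refine h.trans ?_
    have hc : (0 : ℝ) < m.choose k := by exact_mod_cast hchoose
    have hm : (0 : ℝ) < m := by exact_mod_cast (by omega : 0 < m)
    have h1 : (m.choose k : ℝ) * (1 / (((n : ℝ) + m) ^ a * (m.choose k : ℝ)))
        = 1 / ((n : ℝ) + m) ^ a := by
      field_simp
    rw [h1]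
    refine one_div_le_one_div_of_le (by positivity) (pow_le_pow_left₀ hm.le ?_ a)
    linarith [Nat.cast_nonneg (α := ℝ) n]
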